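/- Let $d\ge 1$ and $T>0$, and assume: (j) $\beta\in C^1(\mathbb R)$, $\beta'(r)\ge 0$ for all $r\in\mathbb R$, and $\beta(0)=0$ (so $\beta$ may be degenerate, i.e. $\beta'$ may vanish); (jj) $D\in L^\infty(\mathbb R^d;\mathbb R^d)$; (jjj) $b\in C^1(\mathbb R)$; (jv) for each compact $K\subset\mathbb R$ there is $\alpha_K\in(0,\infty)$ such that $|b'(r)r+b(r)|\le\alpha_K|\beta'(r)|$ for all $r\in K$. Call $y$ a distributional solution on $(0,T)\times\mathbb R^d$ of the nonlinear Fokker–Planck equation $$y_t-\Delta\beta(y)+\operatorname{div}(D\,b(y)\,y)=0$$ if $\beta(y)\in L^1_{\rm loc}((0,T)\times\mathbb R^d)$ and $$\int_0^T\!\!\int_{\mathbb R^d}\bigl(y\,\varphi_t+\beta(y)\,\Delta\varphi+b(y)\,y\,(D\cdot\nabla\varphi)\bigr)\,dx\,dt=0\qquad\text{for all }\varphi\in C_0^\infty((0,T)\times\mathbb R^d).$$ **Theorem 3.1.** Let $y_1,y_2\in L^\infty((0,T)\times\mathbb R^d)$ be two distributional solutions of this equation on $(0,T)\times\mathbb R^d$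 such that $y_1-y_2\in L^\infty(0,T;H^{-1})$, where $H^{-1}=H^{-1}(\mathbb R^d)$ is the dual of $H^1(\mathbb R^d)$, and $$\lim_{t\to0^+}\ \operatorname*{ess\,sup}_{s\in(0,t)}\left|\int_{\mathbb R^d}\bigl(y_1(s,x)-y_2(s,x)\bigr)\varphi(x)\,dx\right|=0\qquad\text{for all }\varphi\in C_0^\infty(\mathbb R^d).$$ Then $y_1=y_2$ a.e. on $(0,T)\times\mathbb R^d$. -/

import Mathlib

open MeasureTheory Set Filter Topology
open scoped ENNReal ContDiff Laplacian RealInnerProductSpace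

noncomputable section

namespace FokkerPlanck

/-- `ℝ^d` with its Euclidean norm. -/
abbrev Space (d : ℕ) : Type := EuclideanSpace ℝ (Fin d)

/-- The space-time cylinder `(0,T) × ℝ^d`. -/
def cylinder (d : ℕ) (T : ℝ) : Set (ℝ × Space d) := Ioo 0 T ×ˢ univ

/-- `φ ∈ C_0^∞(ℝ^d)`: smooth real functions with compact support. -/
structure IsTest {d : ℕ} (φ : Space d → ℝ) : Prop where
  smooth : ContDiff ℝ ∞ φ
  compact : HasCompactSupport φ

/-- `φ ∈ C_0^∞((0,T) × ℝ^d)`, extended by zero. -/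
structure IsSpaceTimeTest {d : ℕ} (T : ℝ) (φ : ℝ × Space d → ℝ) : Prop where
  smooth : ContDiff ℝ ∞ φ
  compact : HasCompactSupport φ
  support : tsupport φ ⊆ cylinder d T

/-! ### The Sobolev space `H^1(ℝ^d)` and its dual `H^{-1}(ℝ^d)` -/

/-- `g` is the weak gradient of `u`: `∫ u ∂_v φ = - ∫ ⟪g, v⟫ φ` for every test function `φ`
and every direction `v`. -/
def IsWeakGradient {d : ℕ} (u : Space d → ℝ) (g : Space d → Space d) : Prop :=
  ∀ φ : Space d → ℝ, IsTest φ → ∀ v : Space d,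
    ∫ x, u x * fderiv ℝ φ x v = - ∫ x, ⟪g x, v⟫ * φ x

theorem IsTest.memLp {d : ℕ} {φ : Space d → ℝ} (h : IsTest φ) (p : ℝ≥0∞) : MemLp φ p volume :=
  h.smooth.continuous.memLp_of_hasCompactSupport h.compact

theorem IsTest.memLp_fderiv {d : ℕ} {φ : Space d → ℝ} (h : IsTest φ) (v : Space d) (p : ℝ≥0∞) :
    MemLp (fun x => fderiv ℝ φ x v) p volume :=
  ((h.smooth.continuous_fderiv (by simp)).clm_apply continuous_const).memLp_of_hasCompactSupport
    (h.compact.fderiv_apply (𝕜 := ℝ) v)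

theorem continuous_gradient {d : ℕ} {φ : Space d → ℝ} (h : IsTest φ) :
    Continuous (gradient φ) :=
  (InnerProductSpace.toDual ℝ (Space d)).symm.continuous.comp
    (h.smooth.continuous_fderiv (by simp))

theorem IsTest.memLp_gradient {d : ℕ} {φ : Space d → ℝ} (h : IsTest φ) (p : ℝ≥0∞) :
    MemLp (gradient φ) p volume :=
  (continuous_gradient h).memLp_of_hasCompactSupport
    ((h.compact.fderiv (𝕜 := ℝ)).comp_left (map_zero _))

theorem integrable_fst {d : ℕ} (u : Lp ℝ 2 (volume : Measure (Space d)))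
    {φ : Space d → ℝ} (h : IsTest φ) (v : Space d) :
    Integrable (fun x => u x * fderiv ℝ φ x v) :=
  (Lp.memLp u).integrable_mul (h.memLp_fderiv v 2)

theorem integrable_snd {d : ℕ} (g : Lp (Space d) 2 (volume : Measure (Space d)))
    {φ : Space d → ℝ} (h : IsTest φ) (v : Space d) :
    Integrable (fun x => ⟪g x, v⟫ * φ x) :=
  ((Lp.memLp g).inner_const v).integrable_mul (h.memLp 2)

/-- `H^1(ℝ^d) = {u ∈ L^2 : ∇u ∈ L^2}`, realised as the space of pairs `(u, ∇u)` inside the Hilbert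
space `L^2(ℝ^d) × L^2(ℝ^d; ℝ^d)`; its norm is `(|u|_2^2 + |∇u|_2^2)^{1/2}`. -/
def H1 (d : ℕ) : Submodule ℝ
    (WithLp 2 (Lp ℝ 2 (volume : Measure (Space d)) ×
      Lp (Space d) 2 (volume : Measure (Space d)))) where
  carrier := {p | IsWeakGradient p.fst p.snd}
  zero_mem' := by
    intro φ hφ v
    have h1 : ∫ x, (0 : Lp ℝ 2 (volume : Measure (Space d))) x * fderiv ℝ φ x v = 0 := by
      rw [integral_congr_ae (g := fun _ => (0 : ℝ)), integral_zero]
      filter_upwards [Lp.coeFn_zero ℝ 2 (volume : Measure (Space d))] with x hx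
      simp only [hx, Pi.zero_apply, zero_mul]
    have h2 : ∫ x, ⟪(0 : Lp (Space d) 2 (volume : Measure (Space d))) x, v⟫ * φ x = 0 := by
      rw [integral_congr_ae (g := fun _ => (0 : ℝ)), integral_zero]
      filter_upwards [Lp.coeFn_zero (Space d) 2 (volume : Measure (Space d))] with x hx
      simp only [hx, Pi.zero_apply, inner_zero_left, zero_mul]
    exact h1.trans (by rw [← neg_zero, ← h2]; rfl)
  add_mem' := by
    intro p q hp hq φ hφ v
    have h1 : ∫ x, (p + q).fst x * fderiv ℝ φ x v
        = (∫ x, p.fst x * fderiv ℝ φ x v) + ∫ x, q.fst x * fderiv ℝ φ x v := by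
      rw [← integral_add (integrable_fst _ hφ v) (integrable_fst _ hφ v)]
      refine integral_congr_ae ?_
      filter_upwards [Lp.coeFn_add p.fst q.fst] with x hx
      simp only [WithLp.add_fst, hx, Pi.add_apply]
      ring
    have h2 : ∫ x, ⟪(p + q).snd x, v⟫ * φ x
        = (∫ x, ⟪p.snd x, v⟫ * φ x) + ∫ x, ⟪q.snd x, v⟫ * φ x := by
      rw [← integral_add (integrable_snd _ hφ v) (integrable_snd _ hφ v)]
      refine integral_congr_ae ?_
      filter_upwards [Lp.coeFn_add p.snd q.snd] with x hx
      simp only [WithLp.add_snd, hx, Pi.add_apply, inner_add_left]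
      ring
    rw [h1, h2, hp φ hφ v, hq φ hφ v]
    ring
  smul_mem' := by
    intro c p hp φ hφ v
    have h1 : ∫ x, (c • p).fst x * fderiv ℝ φ x v = c * ∫ x, p.fst x * fderiv ℝ φ x v := by
      rw [← integral_const_mul]
      refine integral_congr_ae ?_
      filter_upwards [Lp.coeFn_smul c p.fst] with x hx
      simp only [WithLp.smul_fst, hx, Pi.smul_apply, smul_eq_mul]
      ring
    have h2 : ∫ x, ⟪(c • p).snd x, v⟫ * φ x = c * ∫ x, ⟪p.snd x, v⟫ * φ x := by
      rw [← integral_const_mul]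
      refine integral_congr_ae ?_
      filter_upwards [Lp.coeFn_smul c p.snd] with x hx
      simp only [WithLp.smul_snd, hx, Pi.smul_apply, real_inner_smul_left]
      ring
    rw [h1, h2, hp φ hφ v]
    ring

/-- `H^{-1}(ℝ^d)`, the (norm) dual of `H^1(ℝ^d)`. -/
abbrev Hneg1 (d : ℕ) : Type := StrongDual ℝ (H1 d)

theorem IsTest.isWeakGradient {d : ℕ} {φ : Space d → ℝ} (h : IsTest φ) :
    IsWeakGradient φ (gradient φ) := by
  intro ψ hψ v
  have hg : ∀ x, ⟪gradient φ x, v⟫ = fderiv ℝ φ x v := fun x => by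
    simp [gradient]
  simp only [hg]
  exact integral_mul_fderiv_eq_neg_fderiv_mul_of_integrable
    ((h.memLp_fderiv v 2).integrable_mul (hψ.memLp 2))
    ((h.memLp 2).integrable_mul (hψ.memLp_fderiv v 2))
    ((h.memLp 2).integrable_mul (hψ.memLp 2))
    (fun x _ => h.smooth.differentiable (by simp) x)
    (fun x _ => hψ.smooth.differentiable (by simp) x)

/-- A test function, seen as an element of `H^1(ℝ^d)`. -/
def IsTest.toH1 {d : ℕ} {φ : Space d → ℝ} (h : IsTest φ) : H1 d :=
  ⟨WithLp.toLp 2 ((h.memLp 2).toLp φ, (h.memLp_gradient 2).toLp (gradient φ)), by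
    intro ψ hψ v
    have h1 : ∫ x, (h.memLp 2).toLp φ x * fderiv ℝ ψ x v = ∫ x, φ x * fderiv ℝ ψ x v := by
      refine integral_congr_ae ?_
      filter_upwards [(h.memLp 2).coeFn_toLp] with x hx
      simp only [hx]
    have h2 : ∫ x, ⟪(h.memLp_gradient 2).toLp (gradient φ) x, v⟫ * ψ x
        = ∫ x, ⟪gradient φ x, v⟫ * ψ x := by
      refine integral_congr_ae ?_
      filter_upwards [(h.memLp_gradient 2).coeFn_toLp] with x hx
      simp only [hx]
    exact h1.trans ((h.isWeakGradient ψ hψ v).trans (congrArg Neg.neg h2.symm))⟩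

/-- `z ∈ L^∞(0,T; H^{-1})`: there is a strongly measurable, essentially bounded
`Z : (0,T) → H^{-1}(ℝ^d)` such that, for a.e. `t`, the function `z(t, ·)` and the functional `Z t`
are the same distribution on `ℝ^d`. -/
def MemLinftyHneg1 {d : ℕ} (T : ℝ) (z : ℝ × Space d → ℝ) : Prop :=
  ∃ Z : ℝ → Hneg1 d, MemLp Z ∞ (volume.restrict (Ioo 0 T)) ∧
    ∀ᵐ t ∂(volume.restrict (Ioo 0 T)), ∀ (φ : Space d → ℝ) (hφ : IsTest φ),
      Z t hφ.toH1 = ∫ x, z (t, x) * φ x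

/-! ### The equation -/

/-- `y` is a distributional solution on `(0,T) × ℝ^d` of
`y_t - Δ β(y) + div (D b(y) y) = 0`. (Test functions vanish near `t = 0`, so no initial
datum enters.) -/
structure IsDistributionalSolution {d : ℕ} (β b : ℝ → ℝ) (D : Space d → Space d) (T : ℝ)
    (y : ℝ × Space d → ℝ) : Prop where
  locallyIntegrable : LocallyIntegrableOn (fun p => β (y p)) (cylinder d T) volume
  eqn : ∀ φ : ℝ × Space d → ℝ, IsSpaceTimeTest T φ →
    ∫ p in cylinder d T,
      (y p * deriv (fun s => φ (s, p.2)) p.1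
        + β (y p) * (Δ (fun x => φ (p.1, x))) p.2
        + b (y p) * y p * ⟪D p.2, gradient (fun x => φ (p.1, x)) p.2⟫) = 0

end FokkerPlanck

end

/-!
Uniqueness for `y_t - Δβ(y) + div (D b(y) y) = 0` by an energy estimate in a weighted `H^{-1}`.

Let `z = y₁ - y₂`, `w = β(y₁) - β(y₂)` and `G = (b(y₁) y₁ - b(y₂) y₂) D`, so that
`z_t = Δw - div G` with zero initial value. As the solutions are bounded, `β` is Lipschitz with some
constant `L` on their range, and monotone, so `w² ≤ L w z`; the structural condition on `b` gives
`|G| ≤ C |w|` (`sq_sub_le_mul_of_deriv_le`, `abs_sub_le_of_abs_deriv_le`). In `H^{-1}` the diffusion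
then contributes the dissipation `-(w, z) ≤ -|w|²/L`, which absorbs the convection.

In general `z` and `w` are bounded but not in `L^2(ℝ^d)`. Hence everything is multiplied by the
weight `σ(x) = (1 + |x|²)^{-(d+1)}`. As `|∇σ|` and `|Δσ|` are bounded by multiples of `σ`, the
function `σ z` solves an equation of the same form in `L^2`, with additional terms bounded by `σ |w|`
(`inner_slice_flux`).

Let `ι : H^1 → L^2` be the inclusion. Its adjoint solves `u - Δu = v`: it maps `η - Δη` to `η` for
each test function `η` (`adjoint_valueL_sub_laplacian`), and the functions `η - Δη` are dense in
`L^2` by a maximum principle (`ae_eq_zero_of_integral_mul_sub_laplacian`). Thus testing with `σ η`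
determines the curve `ι ι* (σ z) = (I - Δ)⁻¹ (σ z)`, which is the primitive of a bounded curve `g`.
The energy `E = ‖ι* (σ z)‖²` then satisfies `E(t) = 2 ∫₀ᵗ ⟪g, σ z⟫ ≤ K ∫₀ᵗ E`, and Grönwall's
inequality gives `E = 0` (`ae_eq_zero_of_energy`, `ae_eq_zero_of_abstract_equation`).
-/

noncomputable section

namespace FokkerPlanck

/-! ### Vector calculus and test functions -/

theorem laplacian_eq_sum_fderiv {d : ℕ} {f : Space d → ℝ} (hf : ContDiff ℝ 2 f) (x : Space d) :
    (Δ f) x = ∑ i, fderiv ℝ (fun y => fderiv ℝ f y (EuclideanSpace.basisFun (Fin d) ℝ i)) x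
      (EuclideanSpace.basisFun (Fin d) ℝ i) := by
  rw [InnerProductSpace.laplacian_eq_iteratedFDeriv_orthonormalBasis f
    (EuclideanSpace.basisFun (Fin d) ℝ)]
  refine Finset.sum_congr rfl fun i _ => ?_
  have h1 : DifferentiableAt ℝ (fderiv ℝ f) x :=
    (hf.fderiv_right (m := 1) (by norm_num)).differentiable (by norm_num) x
  rw [iteratedFDeriv_two_apply, fderiv_clm_apply h1 (differentiableAt_const _)]
  simp

theorem inner_gradient_left {d : ℕ} (f : Space d → ℝ) (x v : Space d) :
    ⟪gradient f x, v⟫ = fderiv ℝ f x v := by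
  simp [gradient]

theorem inner_gradient_gradient {d : ℕ} (f g : Space d → ℝ) (x : Space d) :
    ⟪gradient f x, gradient g x⟫ = ∑ i, fderiv ℝ f x (EuclideanSpace.basisFun (Fin d) ℝ i) *
      fderiv ℝ g x (EuclideanSpace.basisFun (Fin d) ℝ i) := by
  rw [← (EuclideanSpace.basisFun (Fin d) ℝ).sum_inner_mul_inner]
  refine Finset.sum_congr rfl fun i _ => ?_
  rw [inner_gradient_left, real_inner_comm, inner_gradient_left]

theorem gradient_fun_mul {d : ℕ} {f g : Space d → ℝ} {x : Space d} (hf : DifferentiableAt ℝ f x)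
    (hg : DifferentiableAt ℝ g x) :
    gradient (fun y => f y * g y) x = f x • gradient g x + g x • gradient f x := by
  simp only [gradient, fderiv_fun_mul hf hg, map_add, map_smul]

theorem laplacian_fun_mul {d : ℕ} {f g : Space d → ℝ} (hf : ContDiff ℝ 2 f) (hg : ContDiff ℝ 2 g)
    (x : Space d) :
    (Δ (fun y => f y * g y)) x
      = f x * (Δ g) x + 2 * ⟪gradient f x, gradient g x⟫ + g x * (Δ f) x := by
  rw [laplacian_eq_sum_fderiv (hf.mul hg), laplacian_eq_sum_fderiv hf, laplacian_eq_sum_fderiv hg,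
    inner_gradient_gradient, Finset.mul_sum, Finset.mul_sum, Finset.mul_sum,
    ← Finset.sum_add_distrib, ← Finset.sum_add_distrib]
  refine Finset.sum_congr rfl fun i _ => ?_
  set e := EuclideanSpace.basisFun (Fin d) ℝ i
  have df : Differentiable ℝ f := hf.differentiable (by norm_num)
  have dg : Differentiable ℝ g := hg.differentiable (by norm_num)
  have df' : Differentiable ℝ (fun y => fderiv ℝ f y e) :=
    ((hf.fderiv_right (m := 1) (by norm_num)).clm_apply contDiff_const).differentiable
      (by norm_num)
  have dg' : Differentiable ℝ (fun y => fderiv ℝ g y e) :=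
    ((hg.fderiv_right (m := 1) (by norm_num)).clm_apply contDiff_const).differentiable
      (by norm_num)
  have h : (fun y => fderiv ℝ (fun y => f y * g y) y e)
      = fun y => f y * fderiv ℝ g y e + g y * fderiv ℝ f y e := by
    funext y
    rw [fderiv_fun_mul (df y) (dg y)]
    simp
  rw [h, fderiv_fun_add ((df x).fun_mul (dg' x)) ((dg x).fun_mul (df' x)),
    fderiv_fun_mul (df x) (dg' x),
    fderiv_fun_mul (dg x) (df' x)]
  simp only [add_apply, smul_apply, smul_eq_mul]
  ring

theorem IsTest.fderiv_apply {d : ℕ} {φ : Space d → ℝ} (h : IsTest φ) (v : Space d) :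
    IsTest (fun x => fderiv ℝ φ x v) where
  smooth := (h.smooth.fderiv_right (m := ∞) (by simp)).clm_apply contDiff_const
  compact := h.compact.fderiv_apply (𝕜 := ℝ) v

theorem IsTest.contDiff_two {d : ℕ} {φ : Space d → ℝ} (h : IsTest φ) : ContDiff ℝ 2 φ :=
  h.smooth.of_le (by norm_cast)

theorem IsTest.sum {d : ℕ} {ι : Type*} (s : Finset ι) {φ : ι → Space d → ℝ}
    (h : ∀ i, IsTest (φ i)) : IsTest (fun x => ∑ i ∈ s, φ i x) := by
  classical
  induction s using Finset.induction_on with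
  | empty =>
    simp only [Finset.sum_empty]
    exact ⟨contDiff_const, HasCompactSupport.zero⟩
  | insert a s ha ih =>
    simp only [Finset.sum_insert ha]
    exact ⟨(h a).smooth.add ih.smooth, (h a).compact.add ih.compact⟩

theorem IsTest.laplacian {d : ℕ} {φ : Space d → ℝ} (h : IsTest φ) : IsTest (Δ φ) := by
  have : Δ φ = fun x => ∑ i,
      fderiv ℝ (fun y => fderiv ℝ φ y (EuclideanSpace.basisFun (Fin d) ℝ i)) x
      (EuclideanSpace.basisFun (Fin d) ℝ i) := funext (laplacian_eq_sum_fderiv h.contDiff_two)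
  rw [this]
  exact IsTest.sum _ fun i => (h.fderiv_apply _).fderiv_apply _

theorem IsTest.mul_left {d : ℕ} {φ σ : Space d → ℝ} (h : IsTest φ) (hσ : ContDiff ℝ ∞ σ) :
    IsTest (fun x => σ x * φ x) :=
  ⟨hσ.mul h.smooth, h.compact.mul_left⟩

/-! ### The weight -/

/-- The weight `σ(x) = (1 + |x|²)^{-(d+1)}`. The exponent makes `σ` square integrable, and, unlike
a Gaussian, `σ` decays slowly enough to dominate its own gradient and Laplacian. -/
def weight (d : ℕ) (x : Space d) : ℝ := ((1 + ‖x‖ ^ 2) ^ (d + 1))⁻¹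

theorem one_add_sq_pos {d : ℕ} (x : Space d) : 0 < 1 + ‖x‖ ^ 2 := by positivity

theorem weight_pos {d : ℕ} (x : Space d) : 0 < weight d x := by
  unfold weight; positivity

theorem contDiff_weight (d : ℕ) : ContDiff ℝ ∞ (weight d) :=
  ((contDiff_const.add (contDiff_norm_sq ℝ)).pow _).inv fun x => by positivity

theorem memLp_weight (d : ℕ) : MemLp (weight d) 2 volume := by
  refine (memLp_two_iff_integrable_sq (contDiff_weight d).continuous.aestronglyMeasurable).2 ?_
  have h := integrable_rpow_neg_one_add_norm_sq (E := Space d) (μ := volume) (r := 4 * (d + 1))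
    (by simp only [finrank_euclideanSpace, Fintype.card_fin]; linarith [Nat.cast_nonneg (α := ℝ) d])
  refine h.congr (Eventually.of_forall fun x => ?_)
  have h1 : -(4 * ((d : ℝ) + 1)) / 2 = -((2 * (d + 1) : ℕ) : ℝ) := by push_cast; ring
  simp only [h1, Real.rpow_neg (one_add_sq_pos x).le, Real.rpow_natCast, weight]
  rw [inv_pow, ← pow_mul, mul_comm 2]

/-- The logarithmic derivative of the weight in direction `v` is
`-2 (d + 1) ⟪x, v⟫ / (1 + |x|²)`, a bounded function. -/
theorem fderiv_weight {d : ℕ} (x v : Space d) :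
    fderiv ℝ (weight d) x v
      = weight d x * (-(2 * (d + 1)) * (⟪x, v⟫ * (1 + ‖x‖ ^ 2)⁻¹)) := by
  have h1 : HasFDerivAt (fun y : Space d => 1 + ‖y‖ ^ 2) (2 • innerSL ℝ x) x :=
    (hasStrictFDerivAt_norm_sq x).hasFDerivAt.const_add 1
  have h3 := ((hasDerivAt_inv (pow_ne_zero (d + 1) (one_add_sq_pos x).ne')).comp_hasFDerivAt x
    (h1.pow (d + 1))).fderiv
  have h4 := DFunLike.congr_fun h3 v
  change fderiv ℝ (weight d) x v = _ at h4
  rw [h4]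
  simp [weight]
  have := (one_add_sq_pos x).ne'
  field_simp
  ring

theorem abs_inner_mul_inv_le {d : ℕ} (x v : Space d) :
    |⟪x, v⟫ * (1 + ‖x‖ ^ 2)⁻¹| ≤ ‖v‖ := by
  have h := abs_real_inner_le_norm x v
  rw [abs_mul, abs_of_pos (inv_pos.2 (one_add_sq_pos x)), ← div_eq_mul_inv,
    div_le_iff₀ (one_add_sq_pos x)]
  nlinarith [norm_nonneg v, sq_nonneg (‖x‖ - 1), norm_nonneg x]

theorem norm_gradient_weight_le {d : ℕ} (x : Space d) :
    ‖gradient (weight d) x‖ ≤ 2 * (d + 1) * weight d x := by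
  have h := fderiv_weight x (gradient (weight d) x)
  rw [← inner_gradient_left, real_inner_self_eq_norm_sq] at h
  have h2 := abs_inner_mul_inv_le x (gradient (weight d) x)
  have h3 : ‖gradient (weight d) x‖ ^ 2 ≤
      weight d x * (2 * (d + 1) * ‖gradient (weight d) x‖) := by
    rw [h]
    refine mul_le_mul_of_nonneg_left ?_ (weight_pos x).le
    have := (abs_le.1 h2).1
    nlinarith
  rcases (norm_nonneg (gradient (weight d) x)).eq_or_lt with h0 | h0
  · rw [← h0]
    have := weight_pos x
    positivity
  · refine le_of_mul_le_mul_right ?_ h0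
    calc _ = ‖gradient (weight d) x‖ ^ 2 := by ring
      _ ≤ _ := h3
      _ = _ := by ring

theorem exists_abs_laplacian_weight_le (d : ℕ) :
    ∃ C : ℝ, 0 ≤ C ∧ ∀ x, |(Δ (weight d)) x| ≤ C * weight d x := by
  refine ⟨d * ((2 * (d + 1)) ^ 2 + 2 * (d + 1) * 3), by positivity, fun x => ?_⟩
  rw [laplacian_eq_sum_fderiv ((contDiff_weight d).of_le (by norm_cast))]
  refine (Finset.abs_sum_le_sum_abs _ _).trans ?_
  have key : ∀ i : Fin d, |fderiv ℝ (fun y => fderiv ℝ (weight d) y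
      (EuclideanSpace.basisFun (Fin d) ℝ i)) x (EuclideanSpace.basisFun (Fin d) ℝ i)|
      ≤ ((2 * (d + 1)) ^ 2 + 2 * (d + 1) * 3) * weight d x := by
    intro i
    set e := EuclideanSpace.basisFun (Fin d) ℝ i
    have he : ‖e‖ = 1 := (EuclideanSpace.basisFun (Fin d) ℝ).orthonormal.1 i
    have h0 := abs_inner_mul_inv_le x e
    rw [he] at h0
    have h1 : HasFDerivAt (fun y : Space d => 1 + ‖y‖ ^ 2) (2 • innerSL ℝ x) x :=
      (hasStrictFDerivAt_norm_sq x).hasFDerivAt.const_add 1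
    have h2 := (hasDerivAt_inv (one_add_sq_pos x).ne').comp_hasFDerivAt x h1
    have h3 : HasFDerivAt (fun y : Space d => ⟪y, e⟫) (innerSL ℝ e) x := by
      simpa [real_inner_comm] using (innerSL ℝ e).hasFDerivAt (x := x)
    have h4 := ((contDiff_weight d).differentiable (by simp) x).hasFDerivAt
    have h5 := (h4.mul ((h3.mul h2).const_mul (-(2 * ((d : ℝ) + 1))))).fderiv
    have h6 : (fun y => fderiv ℝ (weight d) y e)
        = weight d * (fun y => -(2 * ((d : ℝ) + 1)) * ((fun y => ⟪y, e⟫) *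
          ((fun y : ℝ => y⁻¹) ∘ fun y => 1 + ‖y‖ ^ 2) : Space d → ℝ) y) := by
      funext y
      simp [fderiv_weight]
    rw [h6, h5]
    have hw := weight_pos x
    have h7 := inv_pos.2 (one_add_sq_pos x)
    have h8 : (1 + ‖x‖ ^ 2)⁻¹ ≤ 1 := inv_le_one_of_one_le₀ (by nlinarith [sq_nonneg ‖x‖])
    simp only [Pi.mul_apply, Function.comp_apply, add_apply, smul_apply,
      innerSL_apply_apply, smul_eq_mul, nsmul_eq_mul, real_inner_self_eq_norm_sq, he, fderiv_weight]
    set k := ⟪x, e⟫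
    set I := (1 + ‖x‖ ^ 2)⁻¹ with hI
    have h9 : (k * I) ^ 2 ≤ 1 := (sq_le_one_iff_abs_le_one _).2 h0
    have h10 : ((1 + ‖x‖ ^ 2) ^ 2)⁻¹ = I ^ 2 := by rw [hI, inv_pow]
    have h11 : weight d x * (-(2 * ((d : ℝ) + 1)) * (k * (-I ^ 2 * ((2 : ℕ) * k)) + I * 1 ^ 2)) +
        -(2 * ((d : ℝ) + 1)) * (k * I) * (weight d x * (-(2 * ((d : ℝ) + 1)) * (k * I)))
        = ((2 * ((d : ℝ) + 1)) ^ 2 * (k * I) ^ 2 + 2 * ((d : ℝ) + 1) * (2 * (k * I) ^ 2 - I))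
          * weight d x := by
      push_cast
      ring
    rw [h10, h11, abs_mul, abs_of_pos hw]
    refine mul_le_mul_of_nonneg_right ?_ hw.le
    refine (abs_add_le _ _).trans (add_le_add ?_ ?_)
    · rw [abs_of_nonneg (by positivity)]
      exact mul_le_of_le_one_right (by positivity) h9
    · rw [abs_mul, abs_of_nonneg (by positivity : 0 ≤ 2 * ((d : ℝ) + 1))]
      refine mul_le_mul_of_nonneg_left ?_ (by positivity)
      rw [abs_le]
      constructor <;> nlinarith [sq_nonneg (k * I)]
  calc _ ≤ ∑ i : Fin d, ((2 * ((d : ℝ) + 1)) ^ 2 + 2 * (d + 1) * 3) * weight d x :=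
        Finset.sum_le_sum fun i _ => key i
    _ = _ := by simp; ring

/-! ### A maximum principle -/

theorem deriv_deriv_nonpos_of_isLocalMax {h : ℝ → ℝ} {t : ℝ} (hmax : IsLocalMax h t)
    (hc : ContinuousAt h t) : deriv (deriv h) t ≤ 0 := by
  by_contra! hpos
  have hmin := isLocalMin_of_deriv_deriv_pos hpos hmax.deriv_eq_zero hc
  -- A positive second derivative would make `t` a local minimum too, and `h` constant near `t`.
  have hconst : h =ᶠ[𝓝 t] fun _ => h t := by
    filter_upwards [hmax, hmin] with s h1 h2 using le_antisymm h1 h2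
  have h0 : deriv (deriv h) t = 0 := by
    rw [hconst.deriv.deriv_eq]
    simp
  linarith

theorem deriv_comp_line {d : ℕ} {f : Space d → ℝ} (hf : Differentiable ℝ f) (x e : Space d)
    (t : ℝ) : HasDerivAt (fun s : ℝ => f (x + s • e)) (fderiv ℝ f (x + t • e) e) t := by
  have h1 : HasDerivAt (fun s : ℝ => x + s • e) e t := by
    simpa using ((hasDerivAt_id t).smul_const e).const_add x
  exact (hf _).hasFDerivAt.comp_hasDerivAt t h1

/-- The maximum principle for `Δf = f`, for functions bounded above on the whole space: at a maximum
point `x₀` of the penalised function `f - δ|x|²` one has `f x₀ = Δf x₀ ≤ 2 d δ`. -/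
theorem le_zero_of_laplacian_eq_self {d : ℕ} {f : Space d → ℝ} (hf : ContDiff ℝ 2 f) {M : ℝ}
    (hM : ∀ x, f x ≤ M) (hΔ : ∀ x, (Δ f) x = f x) (x : Space d) : f x ≤ 0 := by
  have key : ∀ δ : ℝ, 0 < δ → f x ≤ δ * (‖x‖ ^ 2 + 2 * d) := by
    intro δ hδ
    have hcont : Continuous fun y => f y - δ * ‖y‖ ^ 2 := by
      have := hf.continuous
      fun_prop
    have hlim : Tendsto (fun y => f y - δ * ‖y‖ ^ 2) (cocompact (Space d)) atBot := by
      have h1 : Tendsto (fun y : Space d => M - δ * ‖y‖ ^ 2) (cocompact (Space d)) atBot := by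
        have h2 := ((tendsto_pow_atTop (two_ne_zero)).comp
          (tendsto_norm_cocompact_atTop (E := Space d))).const_mul_atTop hδ
        exact tendsto_atBot_add_const_left _ M (tendsto_neg_atTop_atBot.comp h2)
      exact tendsto_atBot_mono (fun y => by linarith [hM y]) h1
    obtain ⟨x₀, hx₀⟩ := hcont.exists_forall_ge hlim
    have df : Differentiable ℝ f := hf.differentiable (by norm_num)
    have hi : ∀ i, fderiv ℝ (fun y => fderiv ℝ f y (EuclideanSpace.basisFun (Fin d) ℝ i)) x₀
        (EuclideanSpace.basisFun (Fin d) ℝ i) ≤ 2 * δ := by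
      intro i
      set e := EuclideanSpace.basisFun (Fin d) ℝ i
      have he : ‖e‖ = 1 := (EuclideanSpace.basisFun (Fin d) ℝ).orthonormal.1 i
      have df' : Differentiable ℝ (fun y => fderiv ℝ f y e) :=
        ((hf.fderiv_right (m := 1) (by norm_num)).clm_apply contDiff_const).differentiable
          (by norm_num)
      have hn : ∀ s : ℝ, HasDerivAt (fun s : ℝ => δ * ‖x₀ + s • e‖ ^ 2)
          (δ * (2 * ⟪x₀, e⟫ + 2 * s)) s := by
        intro s
        have h1 : (fun s : ℝ => δ * ‖x₀ + s • e‖ ^ 2)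
            = fun s => δ * (‖x₀‖ ^ 2 + 2 * ⟪x₀, e⟫ * s + s ^ 2) := by
          funext s
          rw [norm_add_sq_real, norm_smul, he, real_inner_smul_right, mul_one, Real.norm_eq_abs,
            sq_abs]
          ring
        rw [h1]
        have h2 := ((((hasDerivAt_id s).const_mul (2 * ⟪x₀, e⟫)).const_add (‖x₀‖ ^ 2)).add
          (hasDerivAt_pow 2 s)).const_mul δ
        refine h2.congr_deriv ?_
        simp
      have hd1 : deriv (fun s : ℝ => f (x₀ + s • e) - δ * ‖x₀ + s • e‖ ^ 2)
          = fun s => fderiv ℝ f (x₀ + s • e) e - δ * (2 * ⟪x₀, e⟫ + 2 * s) :=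
        funext fun s => ((deriv_comp_line df x₀ e s).sub (hn s)).deriv
      have hd2 : deriv (deriv (fun s : ℝ => f (x₀ + s • e) - δ * ‖x₀ + s • e‖ ^ 2)) 0
          = fderiv ℝ (fun y => fderiv ℝ f y e) x₀ e - 2 * δ := by
        rw [hd1]
        have h1 := (deriv_comp_line df' x₀ e 0).sub
          ((((hasDerivAt_id (0 : ℝ)).const_mul 2).const_add (2 * ⟪x₀, e⟫)).const_mul δ)
        have h2 := h1.deriv
        simp only [zero_smul, add_zero, mul_one] at h2
        rw [mul_comm 2 δ, ← h2]
        rfl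
      have hmax : IsLocalMax (fun s : ℝ => f (x₀ + s • e) - δ * ‖x₀ + s • e‖ ^ 2) 0 :=
        Eventually.of_forall fun s => by simpa using hx₀ (x₀ + s • e)
      have h0 := deriv_deriv_nonpos_of_isLocalMax hmax
        ((deriv_comp_line df x₀ e 0).sub (hn 0)).continuousAt
      rw [hd2] at h0
      linarith
    have hx₀' : f x₀ ≤ d * (2 * δ) := by
      rw [← hΔ, laplacian_eq_sum_fderiv hf]
      calc _ ≤ ∑ _i : Fin d, 2 * δ := Finset.sum_le_sum fun i _ => hi i
        _ = _ := by simp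
    have := hx₀ x
    nlinarith [sq_nonneg ‖x₀‖]
  have hlim : Tendsto (fun δ : ℝ => δ * (‖x‖ ^ 2 + 2 * d)) (𝓝[>] 0) (𝓝 0) := by
    have : Continuous fun δ : ℝ => δ * (‖x‖ ^ 2 + 2 * d) := by fun_prop
    simpa using (this.tendsto 0).mono_left nhdsWithin_le_nhds
  exact ge_of_tendsto hlim (eventually_nhdsWithin_of_forall key)

theorem eq_zero_of_laplacian_eq_self {d : ℕ} {f : Space d → ℝ} (hf : ContDiff ℝ 2 f) {M : ℝ}
    (hM : ∀ x, |f x| ≤ M) (hΔ : ∀ x, (Δ f) x = f x) (x : Space d) : f x = 0 := by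
  refine le_antisymm
    (le_zero_of_laplacian_eq_self hf (fun y => (le_abs_self _).trans (hM y)) hΔ x) ?_
  have := le_zero_of_laplacian_eq_self (f := -f) (M := M) hf.neg
    (fun y => (neg_le_abs _).trans (hM y)) (fun y => by
      rw [InnerProductSpace.laplacian_neg]; simp [hΔ]) x
  simpa using this

/-! ### Density of the range of `I - Δ` on test functions -/

/-- `I - Δ` has dense range in `L^2` on test functions. If `v` is orthogonal to this range then, for
every test function `θ`, the convolution `v ⋆ θ` is a bounded solution of `Δf = f`, hence zero by
the maximum principle; its value at the origin is the pairing of `v` with the reflection of `θ`. -/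
theorem ae_eq_zero_of_integral_mul_sub_laplacian {d : ℕ} {v : Space d → ℝ} (hv : MemLp v 2 volume)
    (h : ∀ η : Space d → ℝ, IsTest η → ∫ x, v x * (η x - (Δ η) x) = 0) :
    v =ᵐ[volume] 0 := by
  have hloc : LocallyIntegrable v volume := hv.locallyIntegrable (by norm_num)
  let L := ContinuousLinearMap.mul ℝ ℝ
  have hderiv : ∀ θ : Space d → ℝ, IsTest θ → ∀ e : Space d,
      (fun y => fderiv ℝ (convolution v θ L volume) y e)
        = convolution v (fun y => fderiv ℝ θ y e) L volume := by
    intro θ hθ e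
    funext x
    have h1 := (hθ.compact.hasFDerivAt_convolution_right L hloc
      (hθ.smooth.of_le (by norm_cast))  x).fderiv
    rw [h1]
    exact convolution_precompR_apply L hloc (hθ.compact.fderiv (𝕜 := ℝ))
      (hθ.smooth.continuous_fderiv (by simp)) x e
  have htest : ∀ θ : Space d → ℝ, IsTest θ → ∀ x, IsTest (fun y => θ (x - y)) := by
    intro θ hθ x
    refine ⟨hθ.smooth.comp (contDiff_const.sub contDiff_id), ?_⟩
    exact hθ.compact.comp_homeomorph (Homeomorph.subLeft x)
  have hlap : ∀ θ : Space d → ℝ, IsTest θ → ∀ x y,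
      (Δ (fun y => θ (x - y))) y = (Δ θ) (x - y) := by
    intro θ hθ x y
    rw [laplacian_eq_sum_fderiv (htest θ hθ x).contDiff_two,
      laplacian_eq_sum_fderiv hθ.contDiff_two]
    refine Finset.sum_congr rfl fun i _ => ?_
    have h1 : ∀ g : Space d → ℝ, IsTest g → ∀ z e : Space d,
        fderiv ℝ (fun y => g (x - y)) z e = - fderiv ℝ g (x - z) e := by
      intro g hg z e
      have h2 := ((hg.smooth.differentiable (by simp) (x - z)).hasFDerivAt.comp z
        ((hasFDerivAt_id z).const_sub x)).fderiv
      have h3 := DFunLike.congr_fun h2 e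
      simpa [Function.comp_def] using h3
    simp only [h1 θ hθ]
    rw [fderiv_fun_neg]
    simp only [neg_apply, h1 _ (hθ.fderiv_apply _), neg_neg]
  have hconv : ∀ θ : Space d → ℝ, IsTest θ → ∀ x, convolution v θ L volume x = 0 := by
    intro θ hθ
    have hsm : ContDiff ℝ 2 (convolution v θ L volume) :=
      hθ.compact.contDiff_convolution_right (n := 2) L hloc hθ.contDiff_two
    obtain ⟨M, hM⟩ : ∃ M : ℝ, ∀ x, |convolution v θ L volume x| ≤ M := by
      -- Integrate `|v(y) θ(x - y)| ≤ v(y)² + θ(x - y)²`.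
      refine ⟨(∫ y, v y ^ 2) + ∫ y, θ y ^ 2, fun x => ?_⟩
      rw [convolution_def, ← integral_sub_left_eq_self (fun y => θ y ^ 2) volume x,
        ← integral_add hv.integrable_sq ((htest θ hθ x).memLp 2).integrable_sq]
      refine abs_integral_le_integral_abs.trans ?_
      refine integral_mono (hv.integrable_mul ((htest θ hθ x).memLp 2)).abs
        (hv.integrable_sq.add ((htest θ hθ x).memLp 2).integrable_sq) fun y => ?_
      change |v y * θ (x - y)| ≤ v y ^ 2 + θ (x - y) ^ 2
      rw [abs_le]
      constructor <;> nlinarith [sq_nonneg (v y + θ (x - y)), sq_nonneg (v y - θ (x - y)),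
        sq_nonneg (v y), sq_nonneg (θ (x - y))]
    refine eq_zero_of_laplacian_eq_self hsm hM fun x => ?_
    rw [laplacian_eq_sum_fderiv hsm]
    have h1 : ∀ e : Space d, fderiv ℝ (fun y => fderiv ℝ (convolution v θ L volume) y e) x e
        = ∫ y, v y * fderiv ℝ (fun z => fderiv ℝ θ z e) (x - y) e := by
      intro e
      rw [hderiv θ hθ e]
      exact congrFun (hderiv _ (hθ.fderiv_apply e) e) x
    simp only [h1]
    rw [← integral_finsetSum]
    · have h2 := h _ (htest θ hθ x)
      simp only [mul_sub] at h2
      rw [integral_sub] at h2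
      · rw [convolution_def]
        simp only [hlap θ hθ] at h2
        change _ = ∫ y, v y * θ (x - y)
        rw [sub_eq_zero.1 h2]
        refine integral_congr_ae (Eventually.of_forall fun y => ?_)
        simp only [laplacian_eq_sum_fderiv hθ.contDiff_two, Finset.mul_sum]
      · exact hv.integrable_mul ((htest θ hθ x).memLp 2)
      · exact hv.integrable_mul ((htest θ hθ x).laplacian.memLp 2)
    · intro i _
      exact hv.integrable_mul ((htest _ ((hθ.fderiv_apply _).fderiv_apply _) x).memLp 2)
  refine ae_eq_zero_of_integral_contDiff_smul_eq_zero hloc fun g hg hgc => ?_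
  have h1 := hconv _ (htest g ⟨hg, hgc⟩ 0) 0
  rw [convolution_def] at h1
  simpa [L, mul_comm] using h1

/-! ### `H^1` as a Hilbert space -/

/-- `L^2(ℝ^d)`. -/
abbrev L2 (d : ℕ) : Type := Lp ℝ 2 (volume : Measure (Space d))

/-- `L^2(ℝ^d; ℝ^d)`. -/
abbrev L2v (d : ℕ) : Type := Lp (Space d) 2 (volume : Measure (Space d))

theorem inner_toLp_left {d : ℕ} {F : Type*} [NormedAddCommGroup F] [InnerProductSpace ℝ F]
    {f : Space d → F} (hf : MemLp f 2 volume) (p : Lp F 2 (volume : Measure (Space d))) :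
    ⟪hf.toLp f, p⟫ = ∫ x, ⟪f x, p x⟫ := by
  rw [L2.inner_def]
  refine integral_congr_ae ?_
  filter_upwards [hf.coeFn_toLp] with x hx
  rw [hx]

/-- The value map `(u, ∇u) ↦ u` from `H^1` to `L^2`. -/
def valueL (d : ℕ) : H1 d →L[ℝ] L2 d := (WithLp.fstL 2 ℝ _ _).comp (H1 d).subtypeL

/-- The gradient map `(u, ∇u) ↦ ∇u` from `H^1` to `L^2`. -/
def gradL (d : ℕ) : H1 d →L[ℝ] L2v d := (WithLp.sndL 2 ℝ _ _).comp (H1 d).subtypeL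

/-- The inner product of `H^1` in terms of values and gradients. -/
theorem H1_inner {d : ℕ} (p q : H1 d) :
    ⟪p, q⟫ = ⟪valueL d p, valueL d q⟫ + ⟪gradL d p, gradL d q⟫ := by
  rw [Submodule.coe_inner, WithLp.prod_inner_apply]
  rfl

theorem IsTest.memLp_smul_const {d : ℕ} {φ : Space d → ℝ} (h : IsTest φ) (v : Space d) :
    MemLp (fun x => φ x • v) 2 volume :=
  (h.smooth.continuous.smul continuous_const).memLp_of_hasCompactSupport h.compact.smul_right

theorem valueL_toH1 {d : ℕ} {η : Space d → ℝ} (h : IsTest η) :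
    valueL d h.toH1 = (h.memLp 2).toLp η := rfl


theorem gradL_toH1 {d : ℕ} {η : Space d → ℝ} (h : IsTest η) :
    gradL d h.toH1 = (h.memLp_gradient 2).toLp (gradient η) := rfl


theorem isWeakGradient_valueL_gradL {d : ℕ} (p : H1 d) :
    IsWeakGradient (valueL d p) (gradL d p) := p.2

-- Unfolding the two projections makes unification in `H1 d` explode.
attribute [irreducible] valueL gradL

theorem isClosed_H1 (d : ℕ) : IsClosed (H1 d : Set (WithLp 2 (L2 d × L2v d))) := by
  have h : (H1 d : Set (WithLp 2 (L2 d × L2v d)))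
      = ⋂ (φ : Space d → ℝ) (h : IsTest φ) (v : Space d),
        {p | ⟪(h.memLp_fderiv v 2).toLp _, p.fst⟫ +
          ⟪(h.memLp_smul_const v).toLp _, p.snd⟫ = 0} := by
    ext p
    simp only [mem_iInter, mem_ofPred_eq, SetLike.mem_coe]
    refine forall_congr' fun φ => forall_congr' fun h => forall_congr' fun v => ?_
    rw [inner_toLp_left, inner_toLp_left]
    simp only [real_inner_smul_left]
    rw [eq_neg_iff_add_eq_zero]
    refine Eq.congr_left (congrArg₂ (· + ·) (integral_congr_ae ?_) (integral_congr_ae ?_))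
    · exact Eventually.of_forall fun x => by simp
    · exact Eventually.of_forall fun x => by simp [real_inner_comm, mul_comm]
  rw [h]
  refine isClosed_iInter fun φ => isClosed_iInter fun h => isClosed_iInter fun v => ?_
  refine isClosed_eq ?_ continuous_const
  exact (continuous_const.inner (WithLp.fstL 2 ℝ _ _).continuous).add
    (continuous_const.inner (WithLp.sndL 2 ℝ _ _).continuous)

instance completeSpace_H1 (d : ℕ) : CompleteSpace (H1 d) :=
  (isClosed_H1 d).completeSpace_coe

theorem IsTest.memLp_sub_laplacian {d : ℕ} {η : Space d → ℝ} (h : IsTest η) :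
    MemLp (fun x => η x - (Δ η) x) 2 volume :=
  (h.memLp 2).sub (h.laplacian.memLp 2)

theorem IsTest.integral_inner_gradient {d : ℕ} {η : Space d → ℝ} (h : IsTest η) {u : L2 d}
    {g : L2v d} (hu : IsWeakGradient u g) :
    ∫ x, ⟪gradient η x, g x⟫ = - ∫ x, u x * (Δ η) x := by
  simp only [inner_gradient_left]
  set e := EuclideanSpace.basisFun (Fin d) ℝ
  have h1 : ∫ x, fderiv ℝ η x (g x) = ∑ i, ∫ x, ⟪g x, e i⟫ * fderiv ℝ η x (e i) := by
    rw [← integral_finsetSum _ fun i _ => integrable_snd g (h.fderiv_apply (e i)) (e i)]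
    refine integral_congr_ae (Eventually.of_forall fun x => ?_)
    beta_reduce
    conv_lhs => rw [← e.sum_repr (g x)]
    simp only [map_sum, map_smul, smul_eq_mul, e.repr_apply_apply]
    exact Finset.sum_congr rfl fun i _ => by rw [real_inner_comm]
  have h2 : ∫ x, u x * (Δ η) x
      = ∑ i, ∫ x, u x * fderiv ℝ (fun y => fderiv ℝ η y (e i)) x (e i) := by
    rw [← integral_finsetSum _ fun i _ => integrable_fst u (h.fderiv_apply (e i)) (e i)]
    refine integral_congr_ae (Eventually.of_forall fun x => ?_)
    simp only [laplacian_eq_sum_fderiv h.contDiff_two, Finset.mul_sum]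
    rfl
  rw [h1, h2, ← Finset.sum_neg_distrib]
  exact Finset.sum_congr rfl fun i _ => by rw [hu _ (h.fderiv_apply (e i)) (e i), neg_neg]

theorem IsTest.inner_add_inner_gradient {d : ℕ} {η : Space d → ℝ} (h : IsTest η) {u : L2 d}
    {g : L2v d} (hu : IsWeakGradient u g) :
    ⟪(h.memLp 2).toLp η, u⟫ + ⟪(h.memLp_gradient 2).toLp (gradient η), g⟫
      = ⟪h.memLp_sub_laplacian.toLp (fun x => η x - (Δ η) x), u⟫ := by
  rw [inner_toLp_left (h.memLp 2), inner_toLp_left (h.memLp_gradient 2),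
    inner_toLp_left h.memLp_sub_laplacian, h.integral_inner_gradient hu, ← sub_eq_add_neg,
    ← integral_sub]
  · refine integral_congr_ae (Eventually.of_forall fun x => ?_)
    simp only [RCLike.inner_apply, conj_trivial]
    ring
  · exact ((Lp.memLp u).integrable_mul (h.memLp 2)).congr
      (Eventually.of_forall fun x => by simp [mul_comm])
  · exact (Lp.memLp u).integrable_mul (h.laplacian.memLp 2)

/-- The adjoint of the inclusion `H^1 → L^2` is the solution operator of `u - Δu = v`. -/
theorem adjoint_valueL_sub_laplacian {d : ℕ} {η : Space d → ℝ} (h : IsTest η) :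
    (valueL d).adjoint (h.memLp_sub_laplacian.toLp (fun x => η x - (Δ η) x)) = h.toH1 := by
  refine ext_inner_right ℝ fun p => ?_
  have h1 := H1_inner h.toH1 p
  have h2 := h.inner_add_inner_gradient (isWeakGradient_valueL_gradL p)
  have h3 : ⟪h.toH1, p⟫ = _ := h1.trans ((congrArg₂ (· + ·)
    (congrArg (⟪·, valueL d p⟫) (valueL_toH1 h))
    (congrArg (⟪·, gradL d p⟫) (gradL_toH1 h))).trans h2)
  exact ((valueL d).adjoint_inner_left p _).trans h3.symm

theorem adjoint_valueL_injective {d : ℕ} {v : L2 d} (hv : (valueL d).adjoint v = 0) : v = 0 := by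
  refine (Lp.eq_zero_iff_ae_eq_zero).2 ?_
  refine ae_eq_zero_of_integral_contDiff_smul_eq_zero
    ((Lp.memLp v).locallyIntegrable (by norm_num)) fun g hg hgc => ?_
  have h : IsTest g := ⟨hg, hgc⟩
  have h1 : ⟪valueL d h.toH1, v⟫ = 0 := by
    rw [← ContinuousLinearMap.adjoint_inner_right, hv, inner_zero_right]
  rw [valueL_toH1, inner_toLp_left] at h1
  simpa [mul_comm] using h1

/-! ### The energy argument in Hilbert space -/

/-- Grönwall's inequality for a bounded measurable function satisfying the integral inequality
almost everywhere only: iteration gives `E t ≤ C (K t)^n / n!` for all `n`. -/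
theorem ae_eq_zero_of_le_integral {E : ℝ → ℝ} {T C K : ℝ} (hK : 0 ≤ K)
    (hE : AEStronglyMeasurable E (volume.restrict (Ioo 0 T)))
    (hE0 : ∀ t, 0 ≤ E t) (hEC : ∀ t, E t ≤ C)
    (h : ∀ᵐ t ∂(volume.restrict (Ioo 0 T)), E t ≤ K * ∫ s in 0..t, E s) :
    ∀ᵐ t ∂(volume.restrict (Ioo 0 T)), E t = 0 := by
  have hint : ∀ t ∈ Ioo 0 T, IntervalIntegrable E volume 0 t := by
    intro t ht
    rw [intervalIntegrable_iff_integrableOn_Ioo_of_le ht.1.le]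
    refine Integrable.of_bound
      (hE.mono_measure (Measure.restrict_mono (Ioo_subset_Ioo_right ht.2.le) le_rfl)) C
      (Eventually.of_forall fun s => ?_)
    rw [Real.norm_of_nonneg (hE0 s)]
    exact hEC s
  have hn : ∀ n : ℕ, ∀ᵐ t ∂(volume.restrict (Ioo 0 T)), E t ≤ C * ((K * t) ^ n / n.factorial) := by
    intro n
    induction n with
    | zero => exact Eventually.of_forall fun t => by simpa using hEC t
    | succ n ih =>
      filter_upwards [h, ae_restrict_mem measurableSet_Ioo] with t ht htT
      refine ht.trans ?_
      have h1 : ∫ s in 0..t, E s ≤ ∫ s in 0..t, C * ((K * s) ^ n / n.factorial) := by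
        refine intervalIntegral.integral_mono_ae_restrict htT.1.le (hint t htT)
          (Continuous.intervalIntegrable (by fun_prop) _ _) ?_
        rw [← restrict_Ioo_eq_restrict_Icc]
        exact ae_mono (Measure.restrict_mono (Ioo_subset_Ioo_right htT.2.le) le_rfl) ih
      have h2 : ∫ s in 0..t, C * ((K * s) ^ n / n.factorial)
          = C * (K ^ n / n.factorial) * (t ^ (n + 1) / (n + 1)) := by
        have : ∀ s, C * ((K * s) ^ n / n.factorial) = C * (K ^ n / n.factorial) * s ^ n := by
          intro s
          rw [mul_pow]
          ring
        simp only [this]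
        rw [intervalIntegral.integral_const_mul, integral_pow]
        simp
      calc K * ∫ s in 0..t, E s ≤ K * (C * (K ^ n / n.factorial) * (t ^ (n + 1) / (n + 1))) :=
            mul_le_mul_of_nonneg_left (h1.trans_eq h2) hK
        _ = C * ((K * t) ^ (n + 1) / (n + 1).factorial) := by
            rw [Nat.factorial_succ, mul_pow]
            push_cast
            field_simp
            ring
  filter_upwards [ae_all_iff.2 hn] with t ht
  refine le_antisymm ?_ (hE0 t)
  have := (FloorSemiring.tendsto_pow_div_factorial_atTop (K * t)).const_mul C
  rw [mul_zero] at this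
  exact ge_of_tendsto' this ht

section Hilbert

variable {V H : Type*} [NormedAddCommGroup V] [InnerProductSpace ℝ V] [CompleteSpace V]
  [NormedAddCommGroup H] [InnerProductSpace ℝ H] [CompleteSpace H]

/-- For `ε > 0` the operator `ε + ι ι*` has a symmetric bounded inverse `R` with `‖ε R‖ ≤ 1`
(Lax–Milgram). -/
theorem exists_resolvent (ι : V →L[ℝ] H) {ε : ℝ} (hε : 0 < ε) :
    ∃ R : H →L[ℝ] H, (∀ x y, ⟪R x, y⟫ = ⟪x, R y⟫) ∧ (∀ x, ε • R x + R (ι (ι.adjoint x)) = x) ∧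
      ∀ x, ε * ‖R x‖ ≤ ‖x‖ := by
  let S : H →L[ℝ] H := ε • ContinuousLinearMap.id ℝ H + ι.comp ι.adjoint
  have hS : ∀ x, S x = ε • x + ι (ι.adjoint x) := fun x => rfl
  let B : H →L[ℝ] H →L[ℝ] ℝ := (innerSL ℝ).comp S
  have hB : ∀ x y, B x y = ⟪S x, y⟫ := fun x y => rfl
  have hSx : ∀ x, ε * ‖x‖ * ‖x‖ ≤ ⟪S x, x⟫ := by
    intro x
    rw [hS, inner_add_left, real_inner_smul_left, real_inner_self_eq_norm_sq,
      ← ContinuousLinearMap.adjoint_inner_right, real_inner_self_eq_norm_sq]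
    nlinarith [sq_nonneg ‖ι.adjoint x‖]
  have hc : IsCoercive B := ⟨ε, hε, hSx⟩
  let e := hc.continuousLinearEquivOfBilin
  have he : ∀ x, e x = S x := fun x => ext_inner_right ℝ fun y => by
    rw [← hB]
    exact hc.continuousLinearEquivOfBilin_apply x y
  have hSR : ∀ x, S (e.symm x) = x := fun x => by rw [← he, e.apply_symm_apply]
  have hRS : ∀ x, e.symm (S x) = x := fun x => by rw [← he, e.symm_apply_apply]
  have hsymm : ∀ x y, ⟪S x, y⟫ = ⟪x, S y⟫ := by
    intro x y
    rw [hS, hS, inner_add_left, inner_add_right, real_inner_smul_left, real_inner_smul_right,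
      ← ContinuousLinearMap.adjoint_inner_right ι, ← ContinuousLinearMap.adjoint_inner_left ι]
  refine ⟨e.symm, fun x y => ?_, fun x => ?_, fun x => ?_⟩
  · have := hsymm (e.symm x) (e.symm y)
    rw [hSR, hSR] at this
    exact this.symm
  · have := hRS x
    rw [hS, map_add, map_smul] at this
    exact this
  · have h1 := (hSx (e.symm x)).trans (real_inner_le_norm _ _)
    rw [hSR] at h1
    rcases (norm_nonneg (e.symm x)).eq_or_lt with h0 | h0
    · change ε * ‖e.symm x‖ ≤ _
      rw [← h0, mul_zero]
      exact norm_nonneg x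
    · exact le_of_mul_le_mul_right h1 h0

theorem dense_range_comp_adjoint (ι : V →L[ℝ] H) (hinj : ∀ v, ι.adjoint v = 0 → v = 0) :
    DenseRange (ι.comp ι.adjoint) := by
  have h : (LinearMap.range (ι.comp ι.adjoint).toLinearMap).topologicalClosure = ⊤ := by
    rw [Submodule.topologicalClosure_eq_top_iff, Submodule.eq_bot_iff]
    intro x hx
    have h1 := (Submodule.mem_orthogonal _ _).1 hx (ι (ι.adjoint x)) ⟨x, rfl⟩
    rw [← ContinuousLinearMap.adjoint_inner_right, real_inner_self_eq_norm_sq] at h1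
    exact hinj x (norm_eq_zero.1 (pow_eq_zero_iff two_ne_zero |>.1 h1))
  exact Submodule.dense_iff_topologicalClosure_eq_top.2 h

/-- Symmetric bounded operators `R n` with `R n (ι ι* x) → x`: the resolvents
`(1 / (n + 1) + ι ι*)⁻¹`. They recover `x` from the more regular `ι ι* x`. -/
theorem exists_regularization (ι : V →L[ℝ] H) (hinj : ∀ v, ι.adjoint v = 0 → v = 0) :
    ∃ R : ℕ → H →L[ℝ] H, (∀ n x y, ⟪R n x, y⟫ = ⟪x, R n y⟫) ∧
      (∀ n x, ‖R n (ι (ι.adjoint x))‖ ≤ 2 * ‖x‖) ∧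
      ∀ x, Tendsto (fun n => R n (ι (ι.adjoint x))) atTop (𝓝 x) := by
  have hε : ∀ n : ℕ, (0 : ℝ) < 1 / (n + 1) := fun n => Nat.one_div_pos_of_nat
  choose R hsymm hR hRb using fun n : ℕ => exists_resolvent ι (hε n)
  have hn : ∀ (n : ℕ) x, ‖((1 : ℝ) / (n + 1)) • R n x‖ ≤ ‖x‖ := fun n x => by
    rw [norm_smul, Real.norm_of_nonneg (hε n).le]
    exact hRb n x
  have h2 : ∀ n x, ‖R n (ι (ι.adjoint x))‖ ≤ 2 * ‖x‖ := fun n x => by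
    rw [← add_sub_cancel_left (((1 : ℝ) / (n + 1)) • R n x) (R n (ι (ι.adjoint x))), hR n x]
    linarith [norm_sub_le x (((1 : ℝ) / (n + 1)) • R n x), hn n x]
  refine ⟨R, hsymm, h2, fun x => ?_⟩
  rw [Metric.tendsto_atTop]
  intro δ hδ
  obtain ⟨y, hy⟩ := (dense_range_comp_adjoint ι hinj).exists_dist_lt x (half_pos hδ)
  have hlim : Tendsto (fun n : ℕ => (1 : ℝ) / (n + 1) * (2 * ‖y‖)) atTop (𝓝 0) := by
    simpa using (tendsto_one_div_add_atTop_nhds_zero_nat (𝕜 := ℝ)).mul_const (2 * ‖y‖)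
  obtain ⟨N, hN⟩ := eventually_atTop.1 (hlim.eventually (gt_mem_nhds (half_pos hδ)))
  refine ⟨N, fun n hnN => ?_⟩
  have h3 : dist (R n (ι (ι.adjoint x))) x = ‖((1 : ℝ) / (n + 1)) • R n x‖ := by
    rw [dist_comm, dist_eq_norm]
    congr 1
    conv_lhs => rw [← hR n x]
    rw [hR n x]
    exact sub_eq_of_eq_add (hR n x).symm
  have h4 : ‖((1 : ℝ) / (n + 1)) • R n (ι (ι.adjoint y))‖ ≤ 1 / (n + 1) * (2 * ‖y‖) := by
    rw [norm_smul, Real.norm_of_nonneg (hε n).le]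
    exact mul_le_mul_of_nonneg_left (h2 n y) (hε n).le
  have h5 := hn n (x - ι (ι.adjoint y))
  rw [map_sub, smul_sub] at h5
  rw [h3]
  have h6 : ‖x - ι (ι.adjoint y)‖ < δ / 2 := by rw [← dist_eq_norm]; exact hy
  have h7 := norm_add_le (((1 : ℝ) / (n + 1)) • R n x - ((1 : ℝ) / (n + 1)) • R n (ι (ι.adjoint y)))
    (((1 : ℝ) / (n + 1)) • R n (ι (ι.adjoint y)))
  rw [sub_add_cancel] at h7
  linarith [hN n hnN]

/-- The chain rule for the quadratic form `⟪U, R U⟫` along the primitive `U` of a bounded curve `g`: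
the composite is Lipschitz, hence absolutely continuous, and its derivative is `2 ⟪g, R U⟫` almost
everywhere. -/
theorem inner_integral_eq_two_mul_integral {R : H →L[ℝ] H} (hR : ∀ x y, ⟪R x, y⟫ = ⟪x, R y⟫)
    {g : ℝ → H} {T N : ℝ} (hgi : IntervalIntegrable g volume 0 T) (hgN : ∀ t, ‖g t‖ ≤ N)
    {t : ℝ} (ht : t ∈ Icc 0 T) :
    ⟪∫ s in 0..t, g s, R (∫ s in 0..t, g s)⟫
      = 2 * ∫ s in 0..t, ⟪g s, R (∫ r in 0..s, g r)⟫ := by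
  have hgt : IntervalIntegrable g volume 0 t :=
    hgi.mono_set (by
      rw [uIcc_of_le ht.1, uIcc_of_le (ht.1.trans ht.2)]
      exact Icc_subset_Icc_right ht.2)
  have hN : 0 ≤ N := (norm_nonneg _).trans (hgN 0)
  have hULip : ∀ r ∈ Icc 0 t, ∀ s ∈ Icc 0 t,
      ‖(∫ τ in 0..r, g τ) - ∫ τ in 0..s, g τ‖ ≤ N * |r - s| := by
    intro r hr s hs
    rw [intervalIntegral.integral_interval_sub_left
      (hgt.mono_set (uIcc_subset_uIcc_left (by rwa [uIcc_of_le ht.1])))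
      (hgt.mono_set (uIcc_subset_uIcc_left (by rwa [uIcc_of_le ht.1])))]
    exact intervalIntegral.norm_integral_le_of_norm_le_const fun x _ => hgN x
  have hUb : ∀ r ∈ Icc 0 t, ‖∫ τ in 0..r, g τ‖ ≤ N * t := by
    intro r hr
    have := hULip r hr 0 ⟨le_rfl, ht.1⟩
    rw [intervalIntegral.integral_same, sub_zero, sub_zero, abs_of_nonneg hr.1] at this
    exact this.trans (mul_le_mul_of_nonneg_left hr.2 hN)
  set f : ℝ → ℝ := fun s => ⟪∫ τ in 0..s, g τ, R (∫ τ in 0..s, g τ)⟫ with hf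
  have hac : AbsolutelyContinuousOnInterval f 0 t := by
    refine LipschitzOnWith.absolutelyContinuousOnInterval
      (K := (2 * (‖R‖ * (N * t)) * N).toNNReal) ?_
    rw [uIcc_of_le ht.1]
    refine LipschitzOnWith.of_dist_le_mul fun r hr s hs => ?_
    have h0 : 0 ≤ 2 * (‖R‖ * (N * t)) * N := by
      have := ht.1
      positivity
    rw [Real.coe_toNNReal _ h0, Real.dist_eq, Real.dist_eq]
    set a := ∫ τ in 0..r, g τ
    set b := ∫ τ in 0..s, g τ
    have h1 : f r - f s = ⟪a - b, R a + R b⟫ := by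
      change ⟪a, R a⟫ - ⟪b, R b⟫ = _
      rw [inner_sub_left, inner_add_right, inner_add_right, ← hR b a, real_inner_comm a (R b)]
      ring
    have hRa : ‖R a‖ ≤ ‖R‖ * (N * t) :=
      (R.le_opNorm a).trans (mul_le_mul_of_nonneg_left (hUb r hr) (norm_nonneg _))
    have hRb : ‖R b‖ ≤ ‖R‖ * (N * t) :=
      (R.le_opNorm b).trans (mul_le_mul_of_nonneg_left (hUb s hs) (norm_nonneg _))
    rw [h1]
    calc |⟪a - b, R a + R b⟫| ≤ ‖a - b‖ * ‖R a + R b‖ := abs_real_inner_le_norm _ _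
      _ ≤ (N * |r - s|) * (2 * (‖R‖ * (N * t))) := by
          refine mul_le_mul (hULip r hr s hs) ?_ (norm_nonneg _) (by positivity)
          linarith [norm_add_le (R a) (R b)]
      _ = _ := by ring
  have hftc := hac.integral_deriv_eq_sub
  have hf0 : f 0 = 0 := by simp [hf]
  rw [hf0, sub_zero] at hftc
  change f t = _
  rw [← hftc, ← intervalIntegral.integral_const_mul]
  refine intervalIntegral.integral_congr_ae ?_
  filter_upwards [hgt.ae_hasDerivAt_integral] with s hs hst
  have h1 := hs (uIoc_subset_uIcc hst) 0 left_mem_uIcc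
  have h2 := (h1.inner ℝ (R.hasFDerivAt.comp_hasDerivAt s h1)).deriv
  refine (show deriv f s = _ from h2).trans ?_
  rw [← hR, real_inner_comm]
  simp only [Function.comp]
  ring

/-- Let `ι ι* z` be the primitive of `g`. Then the energy `‖ι* z‖² = ⟪z, ι ι* z⟫` equals
`2 ∫ ⟪g, z⟫` almost everywhere, so that it vanishes by Grönwall's inequality when
`⟪g, z⟫ ≤ K ‖ι* z‖²`. Since `z` need not be continuous in time, the identity is first proved for the
quadratic forms of the operators `R n` of `exists_regularization`, and then passed to the limit. -/
theorem ae_eq_zero_of_energy (ι : V →L[ℝ] H) (hinj : ∀ v, ι.adjoint v = 0 → v = 0)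
    {T M N K : ℝ} {z g : ℝ → H} (hz : AEStronglyMeasurable z (volume.restrict (Ioo 0 T)))
    (hg : AEStronglyMeasurable g (volume.restrict (Ioo 0 T)))
    (hzM : ∀ t, ‖z t‖ ≤ M) (hgN : ∀ t, ‖g t‖ ≤ N)
    (heq : ∀ᵐ t ∂(volume.restrict (Ioo 0 T)), ι (ι.adjoint (z t)) = ∫ s in 0..t, g s)
    (hK0 : 0 ≤ K)
    (hK : ∀ᵐ t ∂(volume.restrict (Ioo 0 T)), ⟪g t, z t⟫ ≤ K * ‖ι.adjoint (z t)‖ ^ 2) :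
    ∀ᵐ t ∂(volume.restrict (Ioo 0 T)), z t = 0 := by
  obtain ⟨R, hsymm, hRb, hRlim⟩ := exists_regularization ι hinj
  have hN : 0 ≤ N := (norm_nonneg _).trans (hgN 0)
  have hM : 0 ≤ M := (norm_nonneg _).trans (hzM 0)
  have hEmeas : AEStronglyMeasurable (fun t => ‖ι.adjoint (z t)‖ ^ 2)
      (volume.restrict (Ioo 0 T)) :=
    (ι.adjoint.continuous.comp_aestronglyMeasurable hz).norm.pow 2
  have hEb : ∀ t, ‖ι.adjoint (z t)‖ ^ 2 ≤ (‖ι.adjoint‖ * M) ^ 2 := fun t =>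
    pow_le_pow_left₀ (norm_nonneg _) ((ι.adjoint.le_opNorm _).trans
      (mul_le_mul_of_nonneg_left (hzM t) (norm_nonneg _))) 2
  have hE : ∀ᵐ t ∂(volume.restrict (Ioo 0 T)),
      ‖ι.adjoint (z t)‖ ^ 2 ≤ 2 * K * ∫ s in 0..t, ‖ι.adjoint (z s)‖ ^ 2 := by
    filter_upwards [heq, ae_restrict_mem measurableSet_Ioo] with t ht htT
    have hgi : IntervalIntegrable g volume 0 T := by
      rw [intervalIntegrable_iff_integrableOn_Ioo_of_le (htT.1.trans htT.2).le]
      exact Integrable.of_bound hg N (Eventually.of_forall hgN)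
    have hsub : uIoc 0 t ⊆ Ioo 0 T := by
      rw [uIoc_of_le htT.1.le]
      exact fun s hs => ⟨hs.1, hs.2.trans_lt htT.2⟩
    have hmono : volume.restrict (uIoc 0 t) ≤ volume.restrict (Ioo 0 T) :=
      Measure.restrict_mono hsub le_rfl
    have hl1 : Tendsto (fun n => ⟪∫ s in 0..t, g s, R n (∫ s in 0..t, g s)⟫) atTop
        (𝓝 (‖ι.adjoint (z t)‖ ^ 2)) := by
      rw [← ht, ← real_inner_self_eq_norm_sq, ContinuousLinearMap.adjoint_inner_right]
      exact tendsto_const_nhds.inner (hRlim (z t))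
    have hl2 : Tendsto (fun n => ⟪∫ s in 0..t, g s, R n (∫ s in 0..t, g s)⟫) atTop
        (𝓝 (2 * ∫ s in 0..t, ⟪g s, z s⟫)) := by
      simp only [inner_integral_eq_two_mul_integral (hsymm _) hgi hgN ⟨htT.1.le, htT.2.le⟩]
      refine Tendsto.const_mul 2 ?_
      have h1 : ∀ n, ∫ s in 0..t, ⟪g s, R n (∫ r in 0..s, g r)⟫
          = ∫ s in 0..t, ⟪g s, R n (ι (ι.adjoint (z s)))⟫ := by
        intro n
        refine intervalIntegral.integral_congr_ae_restrict ?_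
        filter_upwards [ae_mono hmono heq] with s hs
        rw [hs]
      simp only [h1]
      refine intervalIntegral.tendsto_integral_filter_of_dominated_convergence
        (fun _ => N * (2 * M)) (Eventually.of_forall fun n => ?_)
        (Eventually.of_forall fun n => Eventually.of_forall fun s _ => ?_)
        intervalIntegrable_const (Eventually.of_forall fun s _ => ?_)
      · exact ((hg.mono_measure hmono).inner ((R n).continuous.comp_aestronglyMeasurable
          (ι.continuous.comp_aestronglyMeasurable (ι.adjoint.continuous.comp_aestronglyMeasurable
            (hz.mono_measure hmono)))))
      · refine (norm_inner_le_norm _ _).trans (mul_le_mul (hgN s) ?_ (norm_nonneg _) hN)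
        exact (hRb n (z s)).trans (by linarith [hzM s])
      · exact tendsto_const_nhds.inner (hRlim (z s))
    rw [tendsto_nhds_unique hl1 hl2, mul_assoc, ← intervalIntegral.integral_const_mul K]
    refine mul_le_mul_of_nonneg_left ?_ zero_le_two
    have hmono' : volume.restrict (Icc 0 t) ≤ volume.restrict (Ioo 0 T) := by
      rw [← restrict_Ioo_eq_restrict_Icc]
      exact Measure.restrict_mono (Ioo_subset_Ioo_right htT.2.le) le_rfl
    refine intervalIntegral.integral_mono_ae_restrict htT.1.le ?_ ?_ (ae_mono hmono' hK)
    · refine (intervalIntegrable_const (c := N * M)).mono_fun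
        ((hg.mono_measure hmono).inner (hz.mono_measure hmono)) (Eventually.of_forall fun s => ?_)
      rw [Real.norm_of_nonneg (mul_nonneg hN hM)]
      exact (norm_inner_le_norm _ _).trans (mul_le_mul (hgN s) (hzM s) (norm_nonneg _) hN)
    · refine IntervalIntegrable.const_mul ?_ K
      refine (intervalIntegrable_const (c := (‖ι.adjoint‖ * M) ^ 2)).mono_fun
        ((hEmeas.mono_measure hmono)) (Eventually.of_forall fun s => ?_)
      beta_reduce
      rw [Real.norm_of_nonneg (sq_nonneg _), Real.norm_of_nonneg (sq_nonneg _)]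
      exact hEb s
  filter_upwards [ae_eq_zero_of_le_integral (mul_nonneg zero_le_two hK0) hEmeas
    (fun t => sq_nonneg _) hEb hE] with t ht
  exact hinj _ (norm_eq_zero.1 (pow_eq_zero_iff two_ne_zero |>.1 ht))

end Hilbert

/-! ### Weak derivatives in time -/

/-- Test functions on `(0,T)` with vanishing integral have a test function as antiderivative. -/
theorem exists_antideriv_of_integral_eq_zero {T : ℝ} {ζ : ℝ → ℝ} (hζ : ContDiff ℝ ∞ ζ)
    (hc : HasCompactSupport ζ) (hsupp : tsupport ζ ⊆ Ioo 0 T) (hint : ∫ t, ζ t = 0) :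
    ∃ χ : ℝ → ℝ, ContDiff ℝ ∞ χ ∧ HasCompactSupport χ ∧ tsupport χ ⊆ Ioo 0 T ∧ deriv χ = ζ := by
  rcases (tsupport ζ).eq_empty_or_nonempty with hemp | hne
  · rw [tsupport_eq_empty_iff] at hemp
    exact ⟨0, contDiff_const, HasCompactSupport.zero, by simp [tsupport], by rw [hemp]; ext t; simp⟩
  obtain ⟨a, ha, hamin⟩ := IsCompact.exists_isLeast hc hne
  obtain ⟨b, hb, hbmax⟩ := IsCompact.exists_isGreatest hc hne
  have hder : ∀ t, HasDerivAt (fun t => ∫ s in a..t, ζ s) (ζ t) t := fun t =>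
    intervalIntegral.integral_hasDerivAt_right (hζ.continuous.intervalIntegrable _ _)
      (hζ.continuous.stronglyMeasurableAtFilter _ _) hζ.continuous.continuousAt
  have hderiv : deriv (fun t => ∫ s in a..t, ζ s) = ζ := funext fun t => (hder t).deriv
  have hz : ∀ s, s ∉ Icc a b → ζ s = 0 := fun s hs => by
    by_contra h
    have := subset_tsupport _ (Function.mem_support.2 h)
    exact hs ⟨hamin this, hbmax this⟩
  have hsub : tsupport (fun t => ∫ s in a..t, ζ s) ⊆ Icc a b := by
    refine closure_minimal (fun t ht => ?_) isClosed_Icc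
    by_contra hn
    refine ht ?_
    rw [mem_Icc, not_and_or, not_le, not_le] at hn
    rcases hn with h | h
    · change ∫ s in a..t, ζ s = 0
      rw [intervalIntegral.integral_symm, neg_eq_zero]
      refine intervalIntegral.integral_zero_ae ?_
      have : ∀ᵐ s : ℝ, s ≠ a := by simp [ae_iff, measure_singleton]
      filter_upwards [this] with s hs hst
      rw [uIoc_of_le h.le] at hst
      exact hz s fun h' => hs (le_antisymm hst.2 h'.1)
    · change ∫ s in a..t, ζ s = 0
      have hab : a ≤ b := hamin hb
      rw [intervalIntegral.integral_of_le (hab.trans h.le), ← integral_Icc_eq_integral_Ioc,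
        setIntegral_eq_integral_of_forall_compl_eq_zero, hint]
      exact fun s hs => hz s fun h' => hs ⟨h'.1, h'.2.trans h.le⟩
  refine ⟨_, ?_, HasCompactSupport.of_support_subset_isCompact isCompact_Icc
    (subset_closure.trans hsub), hsub.trans fun s hs =>
      ⟨(hsupp ha).1.trans_le hs.1, hs.2.trans_lt (hsupp hb).2⟩, hderiv⟩
  rw [contDiff_infty_iff_deriv, hderiv]
  exact ⟨fun t => (hder t).differentiableAt, hζ⟩

/-- The lemma of du Bois-Reymond on `(0,T)`. -/
theorem exists_const_of_weak_deriv_eq_zero {T : ℝ} (hT : 0 < T) {k : ℝ → ℝ}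
    (hk : IntegrableOn k (Ioo 0 T))
    (h : ∀ χ : ℝ → ℝ, ContDiff ℝ ∞ χ → HasCompactSupport χ → tsupport χ ⊆ Ioo 0 T →
      ∫ t in Ioo 0 T, deriv χ t * k t = 0) :
    ∃ C : ℝ, ∀ᵐ t ∂(volume.restrict (Ioo 0 T)), k t = C := by
  -- `χ₀` has integral one, so that `η - (∫ η) χ₀` has a compactly supported antiderivative.
  let bump : ContDiffBump (T / 2) := ⟨T / 8, T / 4, by positivity, by linarith⟩
  let χ₀ : ℝ → ℝ := bump.normed volume
  have hχ₀ : ContDiff ℝ ∞ χ₀ := bump.contDiff_normed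
  have hχ₀c : HasCompactSupport χ₀ := bump.hasCompactSupport_normed
  have hχ₀s : tsupport χ₀ ⊆ Ioo 0 T := by
    rw [bump.tsupport_normed_eq, Real.closedBall_eq_Icc]
    intro t ht
    have h1 : T / 2 - T / 4 ≤ t := ht.1
    have h2 : t ≤ T / 2 + T / 4 := ht.2
    constructor <;> linarith
  have hmulint : ∀ g : ℝ → ℝ, Continuous g → HasCompactSupport g →
      IntegrableOn (fun t => g t * k t) (Ioo 0 T) := by
    intro g hg hgc
    obtain ⟨C, hC⟩ := hg.bounded_above_of_compact_support hgc
    exact hk.bdd_mul hg.aestronglyMeasurable (Eventually.of_forall hC)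
  refine ⟨∫ t in Ioo 0 T, χ₀ t * k t, ?_⟩
  set C := ∫ t in Ioo 0 T, χ₀ t * k t with hC
  have hmain := isOpen_Ioo.ae_eq_zero_of_integral_contDiff_smul_eq_zero (μ := volume)
    (U := Ioo 0 T) (f := fun t => k t - C)
    (hk.locallyIntegrableOn.sub (locallyIntegrableOn_const C)) ?_
  · rw [ae_restrict_iff' measurableSet_Ioo]
    filter_upwards [hmain] with t ht htT using sub_eq_zero.1 (ht htT)
  · intro η hη hηc hηs
    have hηi : Integrable η := hη.continuous.integrable_of_hasCompactSupport hηc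
    have hχi : Integrable χ₀ := hχ₀.continuous.integrable_of_hasCompactSupport hχ₀c
    set c := ∫ t, η t with hc
    have hζs : tsupport (fun t => η t - c * χ₀ t) ⊆ tsupport η ∪ tsupport χ₀ :=
      (tsupport_sub _ _).trans (union_subset_union le_rfl (tsupport_mul_subset_right))
    obtain ⟨χ, hχ, hχc, hχs, hχd⟩ := exists_antideriv_of_integral_eq_zero (T := T)
      (ζ := fun t => η t - c * χ₀ t) (hη.sub (contDiff_const.mul hχ₀))
      (hηc.sub hχ₀c.mul_left) (hζs.trans (union_subset hηs hχ₀s)) (by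
        rw [integral_sub hηi (hχi.const_mul c), integral_const_mul, bump.integral_normed]
        simp [hc])
    have h1 := h χ hχ hχc hχs
    rw [hχd] at h1
    have h2 : ∀ t, (η t - c * χ₀ t) * k t = η t * k t - c * (χ₀ t * k t) := fun t => by ring
    simp only [h2] at h1
    rw [integral_sub (hmulint η hη.continuous hηc)
      ((hmulint χ₀ hχ₀.continuous hχ₀c).const_mul c), integral_const_mul] at h1
    have h3 : ∫ t, η t • (k t - C) = ∫ t in Ioo 0 T, (η t * k t - η t * C) := by
      rw [← setIntegral_eq_integral_of_forall_compl_eq_zero (s := Ioo 0 T)]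
      · simp only [smul_eq_mul, mul_sub]
      · intro t ht
        rw [image_eq_zero_of_notMem_tsupport fun h' => ht (hηs h'), zero_smul]
    have h4 : ∫ t in Ioo 0 T, η t = c := by
      rw [setIntegral_eq_integral_of_forall_compl_eq_zero]
      exact fun t ht => image_eq_zero_of_notMem_tsupport fun h' => ht (hηs h')
    rw [h3, integral_sub (hmulint η hη.continuous hηc) (hηi.integrableOn.mul_const C),
      integral_mul_const, h4]
    exact h1

/-- A function with bounded weak derivative `h` on `(0,T)` and zero initial value, attained in the
sense of essential suprema, is the primitive of `h` almost everywhere. -/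
theorem ae_eq_integral_of_weak_deriv {T : ℝ} (hT : 0 < T) {f h : ℝ → ℝ} {N : ℝ}
    (hf : IntegrableOn f (Ioo 0 T)) (hh : IntegrableOn h (Ioo 0 T)) (hN : ∀ t, |h t| ≤ N)
    (hweak : ∀ χ : ℝ → ℝ, ContDiff ℝ ∞ χ → HasCompactSupport χ → tsupport χ ⊆ Ioo 0 T →
      ∫ t in Ioo 0 T, (deriv χ t * f t + χ t * h t) = 0)
    (hlim : Tendsto (fun t : ℝ => essSup (fun s => ‖f s‖ₑ) (volume.restrict (Ioo 0 t)))
      (𝓝[>] 0) (𝓝 0)) :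
    ∀ᵐ t ∂(volume.restrict (Ioo 0 T)), f t = ∫ s in 0..t, h s := by
  have hi : IntervalIntegrable h volume 0 T :=
    (intervalIntegrable_iff_integrableOn_Ioo_of_le hT.le).2 hh
  have hac := hi.absolutelyContinuousOnInterval_intervalIntegral left_mem_uIcc
  have hHi : IntegrableOn (fun t => ∫ s in 0..t, h s) (Ioo 0 T) := by
    have := hac.continuousOn
    rw [uIcc_of_le hT.le] at this
    exact (this.integrableOn_Icc).mono_set Ioo_subset_Icc_self
  have hmulint : ∀ k : ℝ → ℝ, IntegrableOn k (Ioo 0 T) → ∀ g : ℝ → ℝ, Continuous g →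
      HasCompactSupport g → IntegrableOn (fun t => g t * k t) (Ioo 0 T) := by
    intro k hk g hg hgc
    obtain ⟨C, hC⟩ := hg.bounded_above_of_compact_support hgc
    exact hk.bdd_mul hg.aestronglyMeasurable (Eventually.of_forall hC)
  obtain ⟨C, hC⟩ := exists_const_of_weak_deriv_eq_zero hT (hf.sub hHi) (by
    intro χ hχ hχc hχs
    have hd : Continuous (deriv χ) := hχ.continuous_deriv (by simp)
    have h1 := hweak χ hχ hχc hχs
    rw [integral_add (hmulint f hf _ hd hχc.deriv) (hmulint h hh _ hχ.continuous hχc)] at h1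
    have h2 := AbsolutelyContinuousOnInterval.integral_mul_deriv_eq_deriv_mul
      ((hχ.of_le (by simp)).contDiffOn.absolutelyContinuousOnInterval
        (f := χ) (a := 0) (b := T)) hac
    have h3 : ∫ t in 0..T, χ t * deriv (fun t => ∫ s in 0..t, h s) t = ∫ t in 0..T, χ t * h t := by
      refine intervalIntegral.integral_congr_ae ?_
      filter_upwards [hi.ae_hasDerivAt_integral] with t ht htT
      rw [(ht (uIoc_subset_uIcc htT) 0 left_mem_uIcc).deriv]
    have h4 : ∀ t, t ∉ Ioo 0 T → χ t = 0 := fun t ht =>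
      image_eq_zero_of_notMem_tsupport fun h' => ht (hχs h')
    rw [h3, h4 0 (by simp), h4 T (by simp)] at h2
    simp only [zero_mul, sub_zero, zero_sub, intervalIntegral.integral_of_le hT.le,
      integral_Ioc_eq_integral_Ioo] at h2
    have h5 : ∀ t, deriv χ t * (f t - ∫ s in 0..t, h s)
        = deriv χ t * f t - deriv χ t * ∫ s in 0..t, h s := fun t => mul_sub _ _ _
    simp only [Pi.sub_apply, h5]
    rw [integral_sub (hmulint f hf _ hd hχc.deriv) (hmulint _ hHi _ hd hχc.deriv)]
    linarith)
  have hC0 : C = 0 := by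
    by_contra hne
    have hpos : 0 < |C| := abs_pos.2 hne
    have hN0 : 0 ≤ N := (abs_nonneg _).trans (hN 0)
    have h1 : ∀ᶠ t : ℝ in 𝓝[>] 0, essSup (fun s => ‖f s‖ₑ) (volume.restrict (Ioo 0 t))
        < ENNReal.ofReal (|C| / 2) :=
      hlim.eventually (gt_mem_nhds (ENNReal.ofReal_pos.2 (half_pos hpos)))
    have h2 : ∀ᶠ t : ℝ in 𝓝[>] 0, N * t < |C| / 2 := by
      have : Tendsto (fun t : ℝ => N * t) (𝓝 0) (𝓝 0) := by
        simpa using (tendsto_id (x := 𝓝 (0 : ℝ))).const_mul N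
      exact (this.mono_left nhdsWithin_le_nhds).eventually (gt_mem_nhds (half_pos hpos))
    have h3 : ∀ᶠ t : ℝ in 𝓝[>] 0, t < T := nhdsWithin_le_nhds (gt_mem_nhds hT)
    obtain ⟨t, ⟨⟨ht1, ht2⟩, ht3⟩, ht0⟩ := (((h1.and h2).and h3).and self_mem_nhdsWithin).exists
    have ht0 : 0 < t := ht0
    have hmono : volume.restrict (Ioo 0 t) ≤ volume.restrict (Ioo 0 T) :=
      Measure.restrict_mono (Ioo_subset_Ioo_right ht3.le) le_rfl
    have : NeBot (ae (volume.restrict (Ioo 0 t))) := by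
      rw [ae_neBot, Ne, Measure.restrict_eq_zero]
      simp [ht0]
    obtain ⟨s, ⟨hs1, hs2⟩, hs3⟩ := (((ENNReal.ae_le_essSup (μ := volume.restrict (Ioo 0 t))
      (fun s => ‖f s‖ₑ)).and (ae_mono hmono hC)).and (ae_restrict_mem measurableSet_Ioo)).exists
    have h6 : |f s| < |C| / 2 := by
      have := hs1.trans_lt ht1
      rw [Real.enorm_eq_ofReal_abs] at this
      exact (ENNReal.ofReal_lt_ofReal_iff (half_pos hpos)).1 this
    have h7 : |∫ r in 0..s, h r| ≤ N * s := by
      have := intervalIntegral.norm_integral_le_of_norm_le_const (a := 0) (b := s) (f := h) (C := N)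
        fun x _ => hN x
      rwa [sub_zero, abs_of_pos hs3.1] at this
    have h8 : N * s ≤ N * t := mul_le_mul_of_nonneg_left hs3.2.le hN0
    have h9 : |C| ≤ |f s| + |∫ r in 0..s, h r| := by
      rw [← hs2]
      exact abs_sub _ _
    linarith
  filter_upwards [hC] with t ht
  rw [hC0] at ht
  exact sub_eq_zero.1 ht

/-! ### The abstract evolution equation -/

section AbstractEquation

variable {V H W : Type*} [NormedAddCommGroup V] [InnerProductSpace ℝ V] [CompleteSpace V]
  [NormedAddCommGroup H] [InnerProductSpace ℝ H] [CompleteSpace H]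
  [NormedAddCommGroup W] [InnerProductSpace ℝ W] [CompleteSpace W]

/-- Uniqueness for `z' = Δw - div F + q` in `H^{-1}`, with `ι` and `κ` in the roles of the inclusion
`H^1 → L^2` and of the gradient, so that `ι ι* = (I - Δ)⁻¹`. Testing the equation with
`u = ι* z` gives the dissipation `-⟪w, z⟫ ≤ -‖w‖² / L`, which absorbs all the other terms since they
are bounded by `‖w‖ ‖u‖`. The equation is only required against `ι ι* v` for `v` in a total set. -/
theorem ae_eq_zero_of_abstract_equation [SecondCountableTopology H] (ι : V →L[ℝ] H)
    (κ : V →L[ℝ] W) (hι : ∀ p, ‖ι p‖ ≤ ‖p‖) (hκ : ∀ p, ‖κ p‖ ≤ ‖p‖)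
    (hinj : ∀ v, ι.adjoint v = 0 → v = 0) {z w q : ℝ → H} {F : ℝ → W}
    (hz : StronglyMeasurable z) (hw : StronglyMeasurable w) (hq : StronglyMeasurable q)
    (hF : StronglyMeasurable F) {T M N C₁ C₂ L : ℝ} (hzM : ∀ t, ‖z t‖ ≤ M) (hwN : ∀ t, ‖w t‖ ≤ N)
    (hC₁ : 0 ≤ C₁) (hC₂ : 0 ≤ C₂) (hL : 0 < L)
    (hqw : ∀ t, ‖q t‖ ≤ C₁ * ‖w t‖) (hFw : ∀ t, ‖F t‖ ≤ C₂ * ‖w t‖)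
    (hwz : ∀ t, ‖w t‖ ^ 2 ≤ L * ⟪w t, z t⟫) {S : Set H}
    (hS : ∀ x, (∀ v ∈ S, ⟪x, v⟫ = 0) → x = 0)
    (heq : ∀ v ∈ S, ∃ a b, ι (ι.adjoint v) = a ∧ κ (ι.adjoint v) = b ∧
      ∀ᵐ t ∂(volume.restrict (Ioo 0 T)),
        ⟪z t, a⟫ = ∫ s in 0..t, (⟪w s + q s, a⟫ + ⟪F s, b⟫ - ⟪w s, v⟫)) :
    ∀ᵐ t ∂(volume.restrict (Ioo 0 T)), z t = 0 := by
  -- The derivative of `ι ι* z` in time.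
  set g : ℝ → H := fun s => ι (ι.adjoint (w s + q s) + κ.adjoint (F s)) - w s with hg
  have hginner : ∀ s v, ⟪g s, v⟫
      = ⟪w s + q s, ι (ι.adjoint v)⟫ + ⟪F s, κ (ι.adjoint v)⟫ - ⟪w s, v⟫ := by
    intro s v
    rw [hg]
    simp only [inner_sub_left, map_add, inner_add_left]
    rw [← ContinuousLinearMap.adjoint_inner_right ι (ι.adjoint (w s)),
      ← ContinuousLinearMap.adjoint_inner_right ι (ι.adjoint (q s)),
      ← ContinuousLinearMap.adjoint_inner_right ι (κ.adjoint (F s)),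
      ContinuousLinearMap.adjoint_inner_left, ContinuousLinearMap.adjoint_inner_left,
      ContinuousLinearMap.adjoint_inner_left]
  have hgm : StronglyMeasurable g :=
    (ι.continuous.comp_stronglyMeasurable ((ι.adjoint.continuous.comp_stronglyMeasurable
      (hw.add hq)).add (κ.adjoint.continuous.comp_stronglyMeasurable hF))).sub hw
  have hgN : ∀ t, ‖g t‖ ≤ ‖ι‖ * (‖ι.adjoint‖ * (N + C₁ * N) + ‖κ.adjoint‖ * (C₂ * N)) + N := by
    intro t
    refine (norm_sub_le _ _).trans (add_le_add ((ι.le_opNorm _).trans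
      (mul_le_mul_of_nonneg_left ?_ (norm_nonneg _))) (hwN t))
    refine (norm_add_le _ _).trans (add_le_add ?_ ?_)
    · refine (ι.adjoint.le_opNorm _).trans (mul_le_mul_of_nonneg_left ?_ (norm_nonneg _))
      exact (norm_add_le _ _).trans (add_le_add (hwN t)
        ((hqw t).trans (mul_le_mul_of_nonneg_left (hwN t) hC₁)))
    · exact (κ.adjoint.le_opNorm _).trans (mul_le_mul_of_nonneg_left
        ((hFw t).trans (mul_le_mul_of_nonneg_left (hwN t) hC₂)) (norm_nonneg _))
  refine ae_eq_zero_of_energy ι hinj (K := (1 + C₁ + C₂) ^ 2 * L) hz.aestronglyMeasurable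
    hgm.aestronglyMeasurable hzM hgN ?_ (by positivity) (Eventually.of_forall fun t => ?_)
  -- The exceptional null set of times depends on `v`; a countable dense subset of `S` is enough.
  · obtain ⟨D, hDS, hDc, hSD⟩ :=
      (TopologicalSpace.IsSeparable.of_separableSpace S).exists_countable_dense_subset
    have hall : ∀ᵐ t ∂(volume.restrict (Ioo 0 T)), ∀ v ∈ D, ⟪z t, ι (ι.adjoint v)⟫
        = ∫ s in 0..t, (⟪w s + q s, ι (ι.adjoint v)⟫ + ⟪F s, κ (ι.adjoint v)⟫ - ⟪w s, v⟫) :=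
      by
      refine (ae_ball_iff hDc).2 fun v hv => ?_
      obtain ⟨a, b, rfl, rfl, h⟩ := heq v (hDS hv)
      exact h
    filter_upwards [hall] with t ht
    refine sub_eq_zero.1 (hS _ fun v hv => ?_)
    have hcl : IsClosed {v | ⟪ι (ι.adjoint (z t)) - ∫ s in 0..t, g s, v⟫ = 0} :=
      isClosed_eq (continuous_const.inner continuous_id) continuous_const
    refine closure_minimal (fun v hv => ?_) hcl (hSD hv)
    change ⟪ι (ι.adjoint (z t)) - ∫ s in 0..t, g s, v⟫ = 0
    have hgi : IntervalIntegrable g volume 0 t :=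
      intervalIntegrable_const.mono_fun hgm.aestronglyMeasurable
        (Eventually.of_forall fun s => (hgN s).trans (Real.le_norm_self _))
    have h1 : ⟪∫ s in 0..t, g s, v⟫ = ∫ s in 0..t, ⟪g s, v⟫ := by
      have := (innerSL ℝ v).intervalIntegral_comp_comm hgi
      simp only [innerSL_apply_apply] at this
      rw [real_inner_comm, ← this]
      simp only [real_inner_comm]
    rw [inner_sub_left, h1, ← ContinuousLinearMap.adjoint_inner_right ι (ι.adjoint (z t)),
      ContinuousLinearMap.adjoint_inner_left, ht v hv]
    simp only [hginner, sub_self]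
  · rw [hginner]
    set u := ι.adjoint (z t)
    have h1 : ⟪w t + q t, ι u⟫ ≤ (‖w t‖ + C₁ * ‖w t‖) * ‖u‖ :=
      (real_inner_le_norm _ _).trans (mul_le_mul ((norm_add_le _ _).trans
        (add_le_add le_rfl (hqw t))) (hι u) (norm_nonneg _) (by positivity))
    have h2 : ⟪F t, κ u⟫ ≤ (C₂ * ‖w t‖) * ‖u‖ :=
      (real_inner_le_norm _ _).trans (mul_le_mul (hFw t) (hκ u) (norm_nonneg _) (by positivity))
    have h3 := hwz t
    -- Young's inequality, completing the square in `‖w t‖`.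
    have h6 : L * ((1 + C₁ + C₂) * ‖w t‖ * ‖u‖ - ⟪w t, z t⟫)
        ≤ L * ((1 + C₁ + C₂) ^ 2 * L * ‖u‖ ^ 2) := by
      nlinarith [sq_nonneg (‖w t‖ - (1 + C₁ + C₂) * L * ‖u‖ / 2),
        sq_nonneg ((1 + C₁ + C₂) * L * ‖u‖)]
    have h7 := le_of_mul_le_mul_left h6 hL
    linarith

end AbstractEquation

/-! ### Time slices as curves in `L^2` -/

section Slice

variable {d : ℕ} {E : Type*} [NormedAddCommGroup E]

/-- `F` is measurable in space-time and dominated by `M σ(x)`, uniformly in time. -/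
structure WeightBounded (M : ℝ) (F : ℝ × Space d → E) : Prop where
  meas : StronglyMeasurable F
  bound : ∀ p, ‖F p‖ ≤ M * weight d p.2

theorem WeightBounded.memLp {M : ℝ} {F : ℝ × Space d → E} (h : WeightBounded M F) (t : ℝ) :
    MemLp (fun x => F (t, x)) 2 volume :=
  ((memLp_weight d).const_mul M).mono
    (h.meas.comp_measurable measurable_prodMk_left).aestronglyMeasurable
    (Eventually.of_forall fun x => (h.bound (t, x)).trans (Real.le_norm_self _))

/-- The function `F(t, ·)` as an element of `L^2`. -/
def WeightBounded.slice {M : ℝ} {F : ℝ × Space d → E} (h : WeightBounded M F) (t : ℝ) :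
    Lp E 2 (volume : Measure (Space d)) := (h.memLp t).toLp _

theorem WeightBounded.coeFn_slice {M : ℝ} {F : ℝ × Space d → E} (h : WeightBounded M F) (t : ℝ) :
    h.slice t =ᵐ[volume] fun x => F (t, x) := (h.memLp t).coeFn_toLp

theorem WeightBounded.norm_slice_le {M : ℝ} {F : ℝ × Space d → E} (h : WeightBounded M F)
    (t : ℝ) : ‖h.slice t‖ ≤ M * ‖(memLp_weight d).toLp (weight d)‖ := by
  refine Lp.norm_le_mul_norm_of_ae_le_mul ?_
  filter_upwards [h.coeFn_slice t, (memLp_weight d).coeFn_toLp] with x h1 h2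
  rw [h1, h2, Real.norm_of_nonneg (weight_pos x).le]
  exact h.bound (t, x)

/-- A map into a separable metric space is strongly measurable as soon as its distance to every
point is measurable. -/
theorem stronglyMeasurable_of_measurable_edist {Ω X : Type*} [MeasurableSpace Ω]
    [PseudoMetricSpace X] [SecondCountableTopology X] {f : Ω → X}
    (h : ∀ c, Measurable fun a => edist (f a) c) : StronglyMeasurable f := by
  borelize X
  have hb : TopologicalSpace.IsTopologicalBasis {s : Set X | ∃ c r, s = Metric.eball c r} := by
    refine TopologicalSpace.isTopologicalBasis_of_isOpen_of_nhds ?_ ?_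
    · rintro s ⟨c, r, rfl⟩
      exact Metric.isOpen_eball
    · intro c u hc hu
      obtain ⟨r, hr, hru⟩ := EMetric.isOpen_iff.1 hu c hc
      exact ⟨_, ⟨c, r, rfl⟩, Metric.mem_eball_self hr, hru⟩
  have hgen := borel_eq_generateFrom_of_subbasis hb.eq_generateFrom
  have hm : Measurable f := by
    change @Measurable _ _ _ (borel X) f
    rw [hgen]
    refine measurable_generateFrom ?_
    rintro s ⟨c, r, rfl⟩
    exact (h c) measurableSet_Iio
  exact hm.stronglyMeasurable

theorem WeightBounded.stronglyMeasurable_slice [SecondCountableTopology E] {M : ℝ}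
    {F : ℝ × Space d → E} (h : WeightBounded M F) : StronglyMeasurable h.slice := by
  have : Fact ((1 : ℝ≥0∞) ≤ 2) := ⟨by norm_num⟩
  have : Fact ((2 : ℝ≥0∞) ≠ ⊤) := ⟨by norm_num⟩
  refine stronglyMeasurable_of_measurable_edist fun c => ?_
  have h1 : ∀ t, edist (h.slice t) c
      = (∫⁻ x, ‖F (t, x) - c x‖ₑ ^ (2 : ℝ)) ^ (1 / (2 : ℝ)) := by
    intro t
    rw [Lp.edist_def, eLpNorm_eq_lintegral_rpow_enorm_toReal (by norm_num) (by norm_num)]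
    simp only [ENNReal.toReal_ofNat]
    congr 1
    refine lintegral_congr_ae ?_
    filter_upwards [h.coeFn_slice t] with x hx
    simp [hx]
  simp only [h1]
  refine Measurable.pow_const ?_ _
  have h2 : StronglyMeasurable fun p : ℝ × Space d => F p - c p.2 :=
    h.meas.sub ((Lp.stronglyMeasurable c).comp_measurable measurable_snd)
  exact (h2.enorm.pow_const 2).lintegral_prod_right'

end Slice

/-! ### The weighted equation -/

theorem H1_norm_sq {d : ℕ} (p : H1 d) : ‖p‖ ^ 2 = ‖valueL d p‖ ^ 2 + ‖gradL d p‖ ^ 2 := by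
  simpa only [real_inner_self_eq_norm_sq] using H1_inner p p

theorem norm_valueL_le {d : ℕ} (p : H1 d) : ‖valueL d p‖ ≤ ‖p‖ :=
  le_of_sq_le_sq (by rw [H1_norm_sq]; exact le_add_of_nonneg_right (sq_nonneg _)) (norm_nonneg _)

theorem norm_gradL_le {d : ℕ} (p : H1 d) : ‖gradL d p‖ ≤ ‖p‖ :=
  le_of_sq_le_sq (by rw [H1_norm_sq]; exact le_add_of_nonneg_left (sq_nonneg _)) (norm_nonneg _)

theorem WeightBounded.inner_slice {d : ℕ} {E : Type*} [NormedAddCommGroup E]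
    [InnerProductSpace ℝ E] {M : ℝ} {F : ℝ × Space d → E} (h : WeightBounded M F) (t : ℝ)
    {f : Space d → E} (hf : MemLp f 2 volume) :
    ⟪h.slice t, hf.toLp f⟫ = ∫ x, ⟪F (t, x), f x⟫ := by
  rw [L2.inner_def]
  refine integral_congr_ae ?_
  filter_upwards [hf.coeFn_toLp, h.coeFn_slice t] with x h1 h2
  rw [h1, h2]

theorem WeightBounded.norm_slice_le_mul {d : ℕ} {E E' : Type*} [NormedAddCommGroup E]
    [NormedAddCommGroup E'] {M M' C : ℝ} {F : ℝ × Space d → E} {F' : ℝ × Space d → E'}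
    (h : WeightBounded M F) (h' : WeightBounded M' F') (hC : ∀ p, ‖F p‖ ≤ C * ‖F' p‖) (t : ℝ) :
    ‖h.slice t‖ ≤ C * ‖h'.slice t‖ := by
  refine Lp.norm_le_mul_norm_of_ae_le_mul ?_
  filter_upwards [h.coeFn_slice t, h'.coeFn_slice t] with x h1 h2
  rw [h1, h2]
  exact hC (t, x)

theorem WeightBounded.integrable_inner {d : ℕ} {E : Type*} [NormedAddCommGroup E]
    [InnerProductSpace ℝ E] {M : ℝ} {F : ℝ × Space d → E} (h : WeightBounded M F) (t : ℝ)
    {f : Space d → E} (hf : MemLp f 2 volume) : Integrable (fun x => ⟪F (t, x), f x⟫) := by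
  refine (((h.memLp t).norm).integrable_mul hf.norm).mono
    ((h.memLp t).1.inner hf.1) (Eventually.of_forall fun x => ?_)
  simpa using norm_inner_le_norm (𝕜 := ℝ) (F (t, x)) (f x)

/-- The right-hand side of the equation tested with `σ η`, rewritten as a pairing of the weighted
quantities `σ w`, `q = w Δσ + ⟪G, ∇σ⟫` and `F = 2 w ∇σ + σ G` with `η`, `∇η` and
`Δη = η - (η - Δη)`. -/
theorem inner_slice_flux {d : ℕ} {w : ℝ × Space d → ℝ} {G : ℝ × Space d → Space d} {M N P : ℝ}
    (hw : WeightBounded M (fun p => weight d p.2 * w p))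
    (hq : WeightBounded N (fun p => w p * (Δ (weight d)) p.2 + ⟪G p, gradient (weight d) p.2⟫))
    (hF : WeightBounded P (fun p => (2 * w p) • gradient (weight d) p.2 + weight d p.2 • G p))
    {η : Space d → ℝ} (h : IsTest η) (t : ℝ) :
    ⟪hw.slice t + hq.slice t, (h.memLp 2).toLp η⟫
      + ⟪hF.slice t, (h.memLp_gradient 2).toLp (gradient η)⟫
      - ⟪hw.slice t, h.memLp_sub_laplacian.toLp (fun x => η x - (Δ η) x)⟫
      = ∫ x, (w (t, x) * (Δ (fun y => weight d y * η y)) x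
        + ⟪G (t, x), gradient (fun y => weight d y * η y) x⟫) := by
  have i1 := hw.integrable_inner t (h.memLp 2)
  have i2 := hq.integrable_inner t (h.memLp 2)
  have i3 := hF.integrable_inner t (h.memLp_gradient 2)
  have i4 := hw.integrable_inner t h.memLp_sub_laplacian
  rw [inner_add_left, hw.inner_slice t (h.memLp 2), hq.inner_slice t (h.memLp 2),
    hF.inner_slice t (h.memLp_gradient 2), hw.inner_slice t h.memLp_sub_laplacian,
    ← integral_add' i1 i2, ← integral_add' (i1.add i2) i3,
    ← integral_sub' ((i1.add i2).add i3) i4]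
  refine integral_congr_ae (Eventually.of_forall fun x => ?_)
  have hσ : ContDiff ℝ 2 (weight d) := (contDiff_weight d).of_le (by norm_cast)
  simp only [Pi.add_apply, Pi.sub_apply, laplacian_fun_mul hσ h.contDiff_two,
    gradient_fun_mul (hσ.differentiable (by norm_num) x)
      (h.contDiff_two.differentiable (by norm_num) x), RCLike.inner_apply, conj_trivial,
    inner_add_left, inner_add_right, real_inner_smul_left, real_inner_smul_right]
  ring

theorem abs_integral_inner_le {X E : Type*} [MeasurableSpace X] {μ : Measure X}
    [NormedAddCommGroup E] [InnerProductSpace ℝ E] {M : ℝ} {F f : X → E} (hF : ∀ x, ‖F x‖ ≤ M)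
    (hf : Integrable f μ) : |∫ x, ⟪F x, f x⟫ ∂μ| ≤ M * ∫ x, ‖f x‖ ∂μ := by
  rw [← integral_const_mul, ← Real.norm_eq_abs]
  refine norm_integral_le_of_norm_le (hf.norm.const_mul M) (Eventually.of_forall fun x => ?_)
  exact (norm_inner_le_norm (𝕜 := ℝ) _ _).trans (mul_le_mul_of_nonneg_right (hF x) (norm_nonneg _))

theorem integrable_inner_of_bounded {X E : Type*} [MeasurableSpace X] {μ : Measure X}
    [NormedAddCommGroup E] [InnerProductSpace ℝ E] {M : ℝ} {F f : X → E}
    (hFm : AEStronglyMeasurable F μ) (hF : ∀ x, ‖F x‖ ≤ M)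
    (hf : Integrable f μ) : Integrable (fun x => ⟪F x, f x⟫) μ := by
  refine (hf.norm.const_mul M).mono' (hFm.inner hf.1) (Eventually.of_forall fun x => ?_)
  exact (norm_inner_le_norm (𝕜 := ℝ) _ _).trans (mul_le_mul_of_nonneg_right (hF x) (norm_nonneg _))

/-- The weak equation integrated in time: for each test function `ψ`, the pairing of `z t` with `ψ`
is almost everywhere the primitive of the spatial terms. -/
theorem ae_integral_eq_integral {d : ℕ} {T : ℝ} (hT : 0 < T) {z w : ℝ × Space d → ℝ}
    {G : ℝ × Space d → Space d} (hz : StronglyMeasurable z) (hw : StronglyMeasurable w)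
    (hG : StronglyMeasurable G) {M N : ℝ} (hzM : ∀ p, ‖z p‖ ≤ M) (hwM : ∀ p, ‖w p‖ ≤ M)
    (hGN : ∀ p, ‖G p‖ ≤ N) {ψ : Space d → ℝ} (hψ : IsTest ψ)
    (hweak : ∀ χ : ℝ → ℝ, ContDiff ℝ ∞ χ → HasCompactSupport χ → tsupport χ ⊆ Ioo 0 T →
      ∫ t in Ioo 0 T, (deriv χ t * (∫ x, z (t, x) * ψ x)
        + χ t * ∫ x, (w (t, x) * (Δ ψ) x + ⟪G (t, x), gradient ψ x⟫)) = 0)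
    (hlim : Tendsto (fun t : ℝ => essSup (fun s => ‖∫ x, z (s, x) * ψ x‖ₑ)
        (volume.restrict (Ioo 0 t))) (𝓝[>] 0) (𝓝 0)) :
    ∀ᵐ t ∂(volume.restrict (Ioo 0 T)), ∫ x, z (t, x) * ψ x
      = ∫ s in 0..t, ∫ x, (w (s, x) * (Δ ψ) x + ⟪G (s, x), gradient ψ x⟫) := by
  have hψc : Continuous ψ := hψ.smooth.continuous
  have hΔc : Continuous (Δ ψ) := hψ.laplacian.smooth.continuous
  have hgc : Continuous (gradient ψ) := continuous_gradient hψ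
  have hΔi : Integrable (Δ ψ) := hΔc.integrable_of_hasCompactSupport hψ.laplacian.compact
  have hgi : Integrable (gradient ψ) := memLp_one_iff_integrable.1 (hψ.memLp_gradient 1)
  have hslice : ∀ {E : Type} [NormedAddCommGroup E] {F : ℝ × Space d → E},
      StronglyMeasurable F → ∀ t, AEStronglyMeasurable (fun x => F (t, x)) volume :=
    fun hF t => (hF.comp_measurable measurable_prodMk_left).aestronglyMeasurable
  have hfb : ∀ t, ‖∫ x, z (t, x) * ψ x‖ ≤ M * ∫ x, ‖ψ x‖ := by
    intro t
    have := abs_integral_inner_le (μ := volume) (F := fun x => z (t, x))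
      (fun x => hzM (t, x)) (hψc.integrable_of_hasCompactSupport hψ.compact)
    simpa [mul_comm] using this
  have hhb : ∀ t, |∫ x, (w (t, x) * (Δ ψ) x + ⟪G (t, x), gradient ψ x⟫)|
      ≤ M * (∫ x, ‖(Δ ψ) x‖) + N * ∫ x, ‖gradient ψ x‖ := by
    intro t
    have h1 := abs_integral_inner_le (μ := volume) (F := fun x => w (t, x))
      (fun x => hwM (t, x)) hΔi
    have h2 := abs_integral_inner_le (μ := volume) (F := fun x => G (t, x))
      (fun x => hGN (t, x)) hgi
    have i1 := integrable_inner_of_bounded (μ := volume) (F := fun x => w (t, x))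
      (hslice hw t) (fun x => hwM (t, x)) hΔi
    have i2 := integrable_inner_of_bounded (μ := volume) (F := fun x => G (t, x))
      (hslice hG t) (fun x => hGN (t, x)) hgi
    have h3 := integral_add i1 i2
    simp only [RCLike.inner_apply, conj_trivial, mul_comm ((Δ ψ) _)] at h1 h3
    rw [h3]
    exact (abs_add_le _ _).trans (add_le_add h1 h2)
  have hfm : StronglyMeasurable fun t => ∫ x, z (t, x) * ψ x :=
    (hz.mul (hψc.stronglyMeasurable.comp_measurable measurable_snd)).integral_prod_right'
  have hhm : StronglyMeasurable fun t =>
      ∫ x, (w (t, x) * (Δ ψ) x + ⟪G (t, x), gradient ψ x⟫) :=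
    ((hw.mul (hΔc.stronglyMeasurable.comp_measurable measurable_snd)).add
      (hG.inner (hgc.stronglyMeasurable.comp_measurable measurable_snd))).integral_prod_right'
  exact ae_eq_integral_of_weak_deriv hT
    (Integrable.of_bound hfm.aestronglyMeasurable _ (Eventually.of_forall hfb))
    (Integrable.of_bound hhm.aestronglyMeasurable _ (Eventually.of_forall hhb)) hhb hweak hlim

/-- Uniqueness for `z_t = Δw - div G` with bounded data and zero initial value, when
`w² ≤ L w z` and `|G| ≤ C |w|`. After multiplication by `σ` this is an equation in `L^2` whose extra
terms are again bounded by `σ |w|`. -/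
theorem ae_slice_eq_zero_of_weak_equation {d : ℕ} {T : ℝ} (hT : 0 < T) {z w : ℝ × Space d → ℝ}
    {G : ℝ × Space d → Space d} (hz : StronglyMeasurable z) (hw : StronglyMeasurable w)
    (hG : StronglyMeasurable G) {M C L : ℝ} (hzM : ∀ p, |z p| ≤ M) (hwM : ∀ p, |w p| ≤ M)
    (hC : 0 ≤ C) (hGw : ∀ p, ‖G p‖ ≤ C * |w p|) (hL : 0 < L)
    (hwz : ∀ p, w p ^ 2 ≤ L * (w p * z p))
    (hweak : ∀ χ : ℝ → ℝ, ContDiff ℝ ∞ χ → HasCompactSupport χ → tsupport χ ⊆ Ioo 0 T →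
      ∀ ψ : Space d → ℝ, IsTest ψ → ∫ t in Ioo 0 T, (deriv χ t * (∫ x, z (t, x) * ψ x)
        + χ t * ∫ x, (w (t, x) * (Δ ψ) x + ⟪G (t, x), gradient ψ x⟫)) = 0)
    (hlim : ∀ ψ : Space d → ℝ, IsTest ψ →
      Tendsto (fun t : ℝ => essSup (fun s => ‖∫ x, z (s, x) * ψ x‖ₑ)
        (volume.restrict (Ioo 0 t))) (𝓝[>] 0) (𝓝 0)) :
    ∀ᵐ t ∂(volume.restrict (Ioo 0 T)), ∀ᵐ x, z (t, x) = 0 := by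
  obtain ⟨C₀, hC₀, hΔ⟩ := exists_abs_laplacian_weight_le d
  have hσc : Continuous (weight d) := (contDiff_weight d).continuous
  have hσ2 : ContDiff ℝ 2 (weight d) := (contDiff_weight d).of_le (by norm_cast)
  have hσm : StronglyMeasurable fun p : ℝ × Space d => weight d p.2 :=
    hσc.stronglyMeasurable.comp_measurable measurable_snd
  have hΔm : StronglyMeasurable fun p : ℝ × Space d => (Δ (weight d)) p.2 := by
    have : Continuous (Δ (weight d)) := by
      rw [show Δ (weight d) = _ from funext (laplacian_eq_sum_fderiv hσ2)]
      refine continuous_finsetSum _ fun i _ => ?_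
      exact ((((contDiff_weight d).fderiv_right (m := ∞) (by simp)).clm_apply
        contDiff_const).continuous_fderiv (by simp)).clm_apply continuous_const
    exact this.stronglyMeasurable.comp_measurable measurable_snd
  have hgm : StronglyMeasurable fun p : ℝ × Space d => gradient (weight d) p.2 := by
    have : Continuous (gradient (weight d)) :=
      (InnerProductSpace.toDual ℝ (Space d)).symm.continuous.comp
        ((contDiff_weight d).continuous_fderiv (by simp))
    exact this.stronglyMeasurable.comp_measurable measurable_snd
  set C₁ : ℝ := C₀ + C * (2 * (d + 1)) with hC₁
  set C₂ : ℝ := 2 * (2 * (d + 1)) + C with hC₂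
  have hC₁0 : 0 ≤ C₁ := by positivity
  have hC₂0 : 0 ≤ C₂ := by positivity
  have hŵ : ∀ p : ℝ × Space d, ‖weight d p.2 * w p‖ = weight d p.2 * |w p| := fun p => by
    rw [Real.norm_eq_abs, abs_mul, abs_of_pos (weight_pos _)]
  have hqw : ∀ p : ℝ × Space d, ‖w p * (Δ (weight d)) p.2 + ⟪G p, gradient (weight d) p.2⟫‖
      ≤ C₁ * ‖weight d p.2 * w p‖ := by
    intro p
    rw [hŵ, hC₁, add_mul]
    refine (norm_add_le _ _).trans (add_le_add ?_ ?_)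
    · rw [Real.norm_eq_abs, abs_mul]
      calc |w p| * |(Δ (weight d)) p.2| ≤ |w p| * (C₀ * weight d p.2) :=
            mul_le_mul_of_nonneg_left (hΔ _) (abs_nonneg _)
        _ = _ := by ring
    · refine (norm_inner_le_norm _ _).trans ?_
      calc ‖G p‖ * ‖gradient (weight d) p.2‖ ≤ (C * |w p|) * (2 * (d + 1) * weight d p.2) :=
            mul_le_mul (hGw p) (norm_gradient_weight_le _) (norm_nonneg _) (by positivity)
        _ = _ := by ring
  have hFw : ∀ p : ℝ × Space d, ‖(2 * w p) • gradient (weight d) p.2 + weight d p.2 • G p‖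
      ≤ C₂ * ‖weight d p.2 * w p‖ := by
    intro p
    rw [hŵ, hC₂, add_mul]
    refine (norm_add_le _ _).trans (add_le_add ?_ ?_)
    · rw [norm_smul, Real.norm_eq_abs, abs_mul, abs_two]
      calc 2 * |w p| * ‖gradient (weight d) p.2‖ ≤ 2 * |w p| * (2 * (d + 1) * weight d p.2) :=
            mul_le_mul_of_nonneg_left (norm_gradient_weight_le _) (by positivity)
        _ = _ := by ring
    · rw [norm_smul, Real.norm_of_nonneg (weight_pos _).le]
      calc weight d p.2 * ‖G p‖ ≤ weight d p.2 * (C * |w p|) :=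
            mul_le_mul_of_nonneg_left (hGw p) (weight_pos _).le
        _ = _ := by ring
  have hŵM : ∀ p : ℝ × Space d, ‖weight d p.2 * w p‖ ≤ M * weight d p.2 := fun p => by
    rw [hŵ, mul_comm]
    exact mul_le_mul_of_nonneg_right (hwM p) (weight_pos _).le
  have hZ : WeightBounded M (fun p : ℝ × Space d => weight d p.2 * z p) :=
    ⟨hσm.mul hz, fun p => by
      rw [Real.norm_eq_abs, abs_mul, abs_of_pos (weight_pos _), mul_comm]
      exact mul_le_mul_of_nonneg_right (hzM p) (weight_pos _).le⟩
  have hW : WeightBounded M (fun p : ℝ × Space d => weight d p.2 * w p) := ⟨hσm.mul hw, hŵM⟩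
  have hQ : WeightBounded (C₁ * M)
      (fun p : ℝ × Space d => w p * (Δ (weight d)) p.2 + ⟪G p, gradient (weight d) p.2⟫) :=
    ⟨(hw.mul hΔm).add (hG.inner hgm), fun p => (hqw p).trans
      ((mul_le_mul_of_nonneg_left (hŵM p) hC₁0).trans_eq (mul_assoc _ _ _).symm)⟩
  have hF : WeightBounded (C₂ * M)
      (fun p : ℝ × Space d => (2 * w p) • gradient (weight d) p.2 + weight d p.2 • G p) :=
    ⟨((hw.const_mul 2).smul hgm).add (hσm.smul hG), fun p => (hFw p).trans
      ((mul_le_mul_of_nonneg_left (hŵM p) hC₂0).trans_eq (mul_assoc _ _ _).symm)⟩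
  have hslice : ∀ᵐ t ∂(volume.restrict (Ioo 0 T)), hZ.slice t = 0 := by
    have : Fact ((1 : ℝ≥0∞) ≤ 2) := ⟨by norm_num⟩
    have : Fact ((2 : ℝ≥0∞) ≠ ⊤) := ⟨by norm_num⟩
    refine ae_eq_zero_of_abstract_equation (valueL d) (gradL d) norm_valueL_le norm_gradL_le
      (fun v hv => adjoint_valueL_injective hv) (z := hZ.slice) (w := hW.slice) (q := hQ.slice)
      (F := hF.slice) hZ.stronglyMeasurable_slice hW.stronglyMeasurable_slice
      hQ.stronglyMeasurable_slice hF.stronglyMeasurable_slice hZ.norm_slice_le hW.norm_slice_le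
      hC₁0 hC₂0 hL (hQ.norm_slice_le_mul hW hqw) (hF.norm_slice_le_mul hW hFw) ?_
      (S := {v | ∃ (η : Space d → ℝ) (h : IsTest η),
        v = h.memLp_sub_laplacian.toLp (fun x => η x - (Δ η) x)}) ?_ ?_
    · intro t
      rw [← real_inner_self_eq_norm_sq]
      have h1 : ⟪hW.slice t, hW.slice t⟫ = ∫ x, (weight d x * w (t, x)) ^ 2 := by
        refine (hW.inner_slice t (hW.memLp t)).trans ?_
        exact integral_congr_ae (Eventually.of_forall fun x =>
          real_inner_self_eq_norm_sq _ |>.trans (sq_abs _))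
      have h2 : ⟪hW.slice t, hZ.slice t⟫
          = ∫ x, ⟪weight d x * w (t, x), weight d x * z (t, x)⟫ :=
        hW.inner_slice t (hZ.memLp t)
      rw [h1, h2, ← integral_const_mul]
      refine integral_mono (hW.memLp t).integrable_sq
        ((hW.integrable_inner t (hZ.memLp t)).const_mul L) fun x => ?_
      have := mul_le_mul_of_nonneg_left (hwz (t, x)) (sq_nonneg (weight d x))
      simp only [RCLike.inner_apply, conj_trivial]
      nlinarith
    · intro v hv
      refine (Lp.eq_zero_iff_ae_eq_zero).2
        (ae_eq_zero_of_integral_mul_sub_laplacian (Lp.memLp v) ?_)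
      intro η h
      have h1 := hv _ ⟨η, h, rfl⟩
      rw [real_inner_comm, inner_toLp_left h.memLp_sub_laplacian] at h1
      rw [← h1]
      exact integral_congr_ae (Eventually.of_forall fun x => by simp)
    · rintro v ⟨η, h, rfl⟩
      have hψ : IsTest (fun y => weight d y * η y) := h.mul_left (contDiff_weight d)
      have e1 : valueL d ((valueL d).adjoint
          (h.memLp_sub_laplacian.toLp (fun x => η x - (Δ η) x))) = (h.memLp 2).toLp η :=
        (congrArg (valueL d) (adjoint_valueL_sub_laplacian h)).trans (valueL_toH1 h)
      have e2 : gradL d ((valueL d).adjoint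
          (h.memLp_sub_laplacian.toLp (fun x => η x - (Δ η) x)))
          = (h.memLp_gradient 2).toLp (gradient η) :=
        (congrArg (gradL d) (adjoint_valueL_sub_laplacian h)).trans (gradL_toH1 h)
      refine ⟨_, _, e1, e2, ?_⟩
      simp only [inner_slice_flux hW hQ hF h]
      filter_upwards [ae_integral_eq_integral hT hz hw hG hzM hwM
        (fun p => (hGw p).trans (mul_le_mul_of_nonneg_left (hwM p) hC)) hψ
        (fun χ h1 h2 h3 => hweak χ h1 h2 h3 _ hψ) (hlim _ hψ)] with t ht
      rw [← ht, hZ.inner_slice t (h.memLp 2)]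
      refine integral_congr_ae (Eventually.of_forall fun x => ?_)
      simp only [RCLike.inner_apply, conj_trivial]
      ring
  filter_upwards [hslice] with t ht
  have h1 := hZ.coeFn_slice t
  rw [ht] at h1
  filter_upwards [h1, Lp.coeFn_zero ℝ 2 (volume : Measure (Space d))] with x hx h0
  rw [h0] at hx
  exact (mul_eq_zero.1 hx.symm).resolve_left (weight_pos x).ne'

/-! ### Pointwise inequalities for the nonlinearities -/

theorem sq_sub_le_mul_of_deriv_le {β : ℝ → ℝ} {M L : ℝ} (hβ : Differentiable ℝ β)
    (hβ' : ∀ r, 0 ≤ deriv β r) (hL : ∀ r ∈ Icc (-M) M, deriv β r ≤ L) {r s : ℝ}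
    (hr : |r| ≤ M) (hs : |s| ≤ M) : (β r - β s) ^ 2 ≤ L * ((β r - β s) * (r - s)) := by
  wlog h : s < r generalizing r s
  · rcases (not_lt.1 h).eq_or_lt with h' | h'
    · simp [h']
    · have := this hs hr h'
      nlinarith
  obtain ⟨c, hc, hcd⟩ := exists_deriv_eq_slope β h hβ.continuous.continuousOn
    hβ.differentiableOn
  have h1 : β r - β s = deriv β c * (r - s) := by
    rw [hcd, div_mul_cancel₀ _ (sub_pos.2 h).ne']
  have h2 := hL c ⟨(abs_le.1 hs).1.trans hc.1.le, hc.2.le.trans (abs_le.1 hr).2⟩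
  rw [h1]
  have h3 := hβ' c
  have h4 : deriv β c * deriv β c ≤ L * deriv β c := mul_le_mul_of_nonneg_right h2 h3
  nlinarith [sq_nonneg (r - s)]

/-- A derivative bound `|f'| ≤ α β'` integrates to increments, because `α β ± f` are monotone. -/
theorem abs_sub_le_of_abs_deriv_le {f β : ℝ → ℝ} {M α : ℝ} (hf : Differentiable ℝ f)
    (hβ : Differentiable ℝ β) (h : ∀ r ∈ Icc (-M) M, |deriv f r| ≤ α * deriv β r) {r s : ℝ}
    (hr : |r| ≤ M) (hs : |s| ≤ M) : |f r - f s| ≤ |α * (β r - β s)| := by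
  wlog hsr : s ≤ r generalizing r s
  · rw [abs_sub_comm, ← abs_neg (α * _), ← mul_neg, neg_sub]
    exact this hs hr (le_of_not_ge hsr)
  have key : ∀ ε : ℝ, |ε| = 1 → ε * (f r - f s) ≤ α * (β r - β s) := by
    intro ε hε
    have hd : ∀ x, HasDerivAt (fun x => α * β x - ε * f x) (α * deriv β x - ε * deriv f x) x :=
      fun x => ((hβ x).hasDerivAt.const_mul α).sub ((hf x).hasDerivAt.const_mul ε)
    have hm : MonotoneOn (fun x => α * β x - ε * f x) (Icc (-M) M) := by
      refine monotoneOn_of_deriv_nonneg (convex_Icc _ _)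
        (fun x _ => (hd x).continuousAt.continuousWithinAt)
        (fun x _ => (hd x).differentiableAt.differentiableWithinAt) fun x hx => ?_
      rw [(hd x).deriv, sub_nonneg]
      refine (le_abs_self _).trans ?_
      rw [abs_mul, hε, one_mul]
      exact h x (interior_subset hx)
    have := hm (abs_le.1 hs) (abs_le.1 hr) hsr
    simp only at this
    linarith
  refine le_trans (abs_le.2 ⟨?_, ?_⟩) (le_abs_self _)
  · linarith [key (-1) (by simp)]
  · linarith [key 1 (by simp)]

/-! ### Reduction to bounded measurable representatives -/

theorem exists_bounded_representative {X E : Type*} [MeasurableSpace X] {μ : Measure X}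
    [NormedAddCommGroup E] {f : X → E} (hf : MemLp f ∞ μ) :
    ∃ (g : X → E) (M : ℝ), StronglyMeasurable g ∧ (∀ x, ‖g x‖ ≤ M) ∧ f =ᵐ[μ] g := by
  obtain ⟨k, hk, hfk⟩ := hf.1
  set M := lpNorm f ∞ μ
  have hs : MeasurableSet {x | ‖k x‖ ≤ M} := measurableSet_le hk.norm.measurable measurable_const
  refine ⟨{x | ‖k x‖ ≤ M}.indicator k, M, hk.indicator hs, fun x => ?_, ?_⟩
  · by_cases hx : ‖k x‖ ≤ M
    · rwa [indicator_of_mem (show x ∈ {x | ‖k x‖ ≤ M} from hx)]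
    · rw [indicator_of_notMem (show x ∉ {x | ‖k x‖ ≤ M} from hx), norm_zero]
      exact lpNorm_nonneg
  · filter_upwards [hfk, ae_le_lpNorm_exponent_top hf] with x h1 h2
    rw [h1] at h2 ⊢
    rw [indicator_of_mem (show x ∈ {x | ‖k x‖ ≤ M} from h2)]

theorem volume_restrict_cylinder (d : ℕ) (T : ℝ) :
    (volume.restrict (cylinder d T) : Measure (ℝ × Space d))
      = (volume.restrict (Ioo 0 T)).prod volume := by
  rw [cylinder, Measure.volume_eq_prod, ← Measure.prod_restrict, Measure.restrict_univ]

theorem isSpaceTimeTest_mul {d : ℕ} {T : ℝ} {χ : ℝ → ℝ} (hχ : ContDiff ℝ ∞ χ)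
    (hχc : HasCompactSupport χ) (hχs : tsupport χ ⊆ Ioo 0 T) {ψ : Space d → ℝ} (hψ : IsTest ψ) :
    IsSpaceTimeTest T (fun p : ℝ × Space d => χ p.1 * ψ p.2) := by
  have hsub : Function.support (fun p : ℝ × Space d => χ p.1 * ψ p.2)
      ⊆ tsupport χ ×ˢ tsupport ψ := fun p hp =>
    ⟨subset_tsupport _ (left_ne_zero_of_mul hp), subset_tsupport _ (right_ne_zero_of_mul hp)⟩
  have h1 : ContDiff ℝ ∞ fun p : ℝ × Space d => χ p.1 := hχ.comp contDiff_fst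
  have h2 : ContDiff ℝ ∞ fun p : ℝ × Space d => ψ p.2 := hψ.smooth.comp contDiff_snd
  refine ⟨h1.mul h2,
    HasCompactSupport.of_support_subset_isCompact (IsCompact.prod hχc hψ.compact) hsub, ?_⟩
  refine (closure_minimal hsub ((isClosed_tsupport χ).prod (isClosed_tsupport ψ))).trans ?_
  exact prod_mono hχs (subset_univ _)

/-- The equation tested with `χ(t) ψ(x)`, for representatives of the solution and of the drift. -/
theorem IsDistributionalSolution.eqn_prod {d : ℕ} {β b : ℝ → ℝ} {D D' : Space d → Space d} {T : ℝ}
    {y y' : ℝ × Space d → ℝ} (h : IsDistributionalSolution β b D T y)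
    (hD : D =ᵐ[volume] D') (hy : y =ᵐ[volume.restrict (cylinder d T)] y')
    {χ : ℝ → ℝ} (hχ : ContDiff ℝ ∞ χ)
    (hχc : HasCompactSupport χ) (hχs : tsupport χ ⊆ Ioo 0 T) {ψ : Space d → ℝ} (hψ : IsTest ψ) :
    ∫ p, (deriv χ p.1 * (y' p * ψ p.2) + χ p.1 * (β (y' p) * (Δ ψ) p.2
      + ⟪(b (y' p) * y' p) • D' p.2, gradient ψ p.2⟫))
      ∂((volume.restrict (Ioo 0 T)).prod volume) = 0 := by
  refine Eq.trans ?_ (h.eqn _ (isSpaceTimeTest_mul hχ hχc hχs hψ))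
  rw [volume_restrict_cylinder]
  rw [volume_restrict_cylinder] at hy
  have hD2 : ∀ᵐ p : ℝ × Space d ∂((volume.restrict (Ioo 0 T)).prod volume), D p.2 = D' p.2 :=
    Measure.quasiMeasurePreserving_snd.ae hD
  refine integral_congr_ae ?_
  filter_upwards [hy, hD2] with p h1 h2
  have e1 : deriv (fun s => χ s * ψ p.2) p.1 = deriv χ p.1 * ψ p.2 := by
    rw [deriv_mul_const_field]
  have e2 : (Δ (fun x => χ p.1 * ψ x)) p.2 = χ p.1 * (Δ ψ) p.2 :=
    InnerProductSpace.laplacian_smul (χ p.1) hψ.contDiff_two.contDiffAt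
  have e3 : gradient (fun x => χ p.1 * ψ x) p.2 = χ p.1 • gradient ψ p.2 := by
    have := gradient_fun_mul (f := fun _ => χ p.1) (x := p.2) (differentiableAt_const _)
      (hψ.contDiff_two.differentiable (by norm_num) p.2)
    rw [this]
    simp [gradient]
  rw [e1, e2, e3, h1, h2, real_inner_smul_left, real_inner_smul_right]
  ring

theorem integrable_prod_mul_inner {d : ℕ} {E : Type*} [NormedAddCommGroup E]
    [InnerProductSpace ℝ E] {T M : ℝ}
    {F : ℝ × Space d → E} (hF : StronglyMeasurable F) (hM : ∀ p, ‖F p‖ ≤ M)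
    {a : ℝ → ℝ} (ha : Continuous a) (hac : HasCompactSupport a) {f : Space d → E}
    (hf : Integrable f) :
    Integrable (fun p : ℝ × Space d => a p.1 * ⟪F p, f p.2⟫)
      ((volume.restrict (Ioo 0 T)).prod volume) := by
  have h1 : Integrable (fun p : ℝ × Space d => a p.1 • f p.2)
      ((volume.restrict (Ioo 0 T)).prod volume) :=
    Integrable.smul_prod (ha.integrable_of_hasCompactSupport hac).restrict hf
  have h2 := integrable_inner_of_bounded hF.aestronglyMeasurable hM h1
  simpa only [real_inner_smul_right] using h2

section WeakIntegrand

variable {d : ℕ} {T M N P : ℝ} {z w : ℝ × Space d → ℝ} {G : ℝ × Space d → Space d}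
  {χ : ℝ → ℝ} {ψ : Space d → ℝ}

theorem integrable_weak_integrand (hz : StronglyMeasurable z) (hw : StronglyMeasurable w)
    (hG : StronglyMeasurable G) (hzM : ∀ p, ‖z p‖ ≤ M) (hwN : ∀ p, ‖w p‖ ≤ N)
    (hGP : ∀ p, ‖G p‖ ≤ P) (hχ : ContDiff ℝ ∞ χ) (hχc : HasCompactSupport χ) (hψ : IsTest ψ) :
    Integrable (fun p : ℝ × Space d => deriv χ p.1 * (z p * ψ p.2)
      + χ p.1 * (w p * (Δ ψ) p.2 + ⟪G p, gradient ψ p.2⟫))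
      ((volume.restrict (Ioo 0 T)).prod volume) := by
  have i1 := integrable_prod_mul_inner (T := T) hz hzM (hχ.continuous_deriv (by simp)) hχc.deriv
    (memLp_one_iff_integrable.1 (hψ.memLp 1))
  have i2 := integrable_prod_mul_inner (T := T) hw hwN hχ.continuous hχc
    (memLp_one_iff_integrable.1 (hψ.laplacian.memLp 1))
  have i3 := integrable_prod_mul_inner (T := T) hG hGP hχ.continuous hχc
    (memLp_one_iff_integrable.1 (hψ.memLp_gradient 1))
  refine (i1.add (i2.add i3)).congr (Eventually.of_forall fun p => ?_)
  simp only [Pi.add_apply, RCLike.inner_apply, conj_trivial]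
  ring

/-- Fubini's theorem for the equation tested with `χ(t) ψ(x)`. -/
theorem integral_weak_integrand (hz : StronglyMeasurable z) (hw : StronglyMeasurable w)
    (hG : StronglyMeasurable G) (hzM : ∀ p, ‖z p‖ ≤ M) (hwN : ∀ p, ‖w p‖ ≤ N)
    (hGP : ∀ p, ‖G p‖ ≤ P) (hχ : ContDiff ℝ ∞ χ) (hχc : HasCompactSupport χ) (hψ : IsTest ψ) :
    ∫ p, (deriv χ p.1 * (z p * ψ p.2) + χ p.1 * (w p * (Δ ψ) p.2 + ⟪G p, gradient ψ p.2⟫))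
        ∂((volume.restrict (Ioo 0 T)).prod volume)
      = ∫ t in Ioo 0 T, (deriv χ t * (∫ x, z (t, x) * ψ x)
        + χ t * ∫ x, (w (t, x) * (Δ ψ) x + ⟪G (t, x), gradient ψ x⟫)) := by
  rw [integral_prod _ (integrable_weak_integrand hz hw hG hzM hwN hGP hχ hχc hψ)]
  refine integral_congr_ae (Eventually.of_forall fun t => ?_)
  have i1 : Integrable fun x => z (t, x) * ψ x := by
    have := integrable_inner_of_bounded (μ := volume)
      (hz.comp_measurable (measurable_prodMk_left (x := t))).aestronglyMeasurable
      (fun x => hzM (t, x)) (memLp_one_iff_integrable.1 (hψ.memLp 1))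
    exact this.congr (Eventually.of_forall fun x => mul_comm _ _)
  have i2 : Integrable fun x => w (t, x) * (Δ ψ) x := by
    have := integrable_inner_of_bounded (μ := volume)
      (hw.comp_measurable (measurable_prodMk_left (x := t))).aestronglyMeasurable
      (fun x => hwN (t, x)) (memLp_one_iff_integrable.1 (hψ.laplacian.memLp 1))
    exact this.congr (Eventually.of_forall fun x => mul_comm _ _)
  have i3 : Integrable fun x => ⟪G (t, x), gradient ψ x⟫ :=
    integrable_inner_of_bounded (μ := volume)
      (hG.comp_measurable (measurable_prodMk_left (x := t))).aestronglyMeasurable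
      (fun x => hGP (t, x)) (memLp_one_iff_integrable.1 (hψ.memLp_gradient 1))
  have h := integral_add (i1.const_mul (deriv χ t)) ((i2.add i3).const_mul (χ t))
  rw [integral_const_mul, integral_const_mul] at h
  exact h

end WeakIntegrand

end FokkerPlanck

end

theorem theorem3p1 (d : ℕ) (hd : 1 ≤ d) (T : ℝ) (hT : 0 < T)
    (β b : ℝ → ℝ) (D : FokkerPlanck.Space d → FokkerPlanck.Space d)
    (hβ : ContDiff ℝ 1 β) (hβ' : ∀ r, 0 ≤ deriv β r) (hβ0 : β 0 = 0)
    (hD : MemLp D ∞ volume)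
    (hb : ContDiff ℝ 1 b)
    (hbβ : ∀ K : Set ℝ, IsCompact K → ∃ α : ℝ, 0 < α ∧
      ∀ r ∈ K, |deriv b r * r + b r| ≤ α * |deriv β r|)
    (y₁ y₂ : ℝ × FokkerPlanck.Space d → ℝ)
    (hy₁ : MemLp y₁ ∞ (volume.restrict (FokkerPlanck.cylinder d T)))
    (hy₂ : MemLp y₂ ∞ (volume.restrict (FokkerPlanck.cylinder d T)))
    (hsol₁ : FokkerPlanck.IsDistributionalSolution β b D T y₁)
    (hsol₂ : FokkerPlanck.IsDistributionalSolution β b D T y₂)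
    (hH : FokkerPlanck.MemLinftyHneg1 T (fun p => y₁ p - y₂ p))
    (hlim : ∀ φ : FokkerPlanck.Space d → ℝ, FokkerPlanck.IsTest φ →
      Tendsto (fun t : ℝ => essSup (fun s => ‖∫ x, (y₁ (s, x) - y₂ (s, x)) * φ x‖ₑ)
        (volume.restrict (Ioo 0 t))) (𝓝[>] 0) (𝓝 0)) :
    y₁ =ᵐ[volume.restrict (FokkerPlanck.cylinder d T)] y₂ := by
  obtain ⟨D', N, hD'm, hD'N, hDD'⟩ := FokkerPlanck.exists_bounded_representative hD
  obtain ⟨u₁, M₁, hu₁m, hu₁M, hyu₁⟩ := FokkerPlanck.exists_bounded_representative hy₁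
  obtain ⟨u₂, M₂, hu₂m, hu₂M, hyu₂⟩ := FokkerPlanck.exists_bounded_representative hy₂
  have hN : 0 ≤ N := (norm_nonneg _).trans (hD'N 0)
  set M := max M₁ M₂
  have hM₁ : ∀ p, |u₁ p| ≤ M := fun p => (hu₁M p).trans (le_max_left _ _)
  have hM₂ : ∀ p, |u₂ p| ≤ M := fun p => (hu₂M p).trans (le_max_right _ _)
  have hM : 0 ≤ M := (abs_nonneg _).trans (hM₁ (0, 0))
  have hβd : Differentiable ℝ β := hβ.differentiable (by norm_num)
  have hbd : Differentiable ℝ b := hb.differentiable (by norm_num)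
  have hBd : Differentiable ℝ fun r => b r * r := hbd.mul differentiable_id
  obtain ⟨L₀, hL₀⟩ := (isCompact_Icc (a := -M) (b := M)).exists_bound_of_continuousOn
    (hβ.continuous_deriv le_rfl).continuousOn
  set L := max L₀ 1
  have hL : 0 < L := zero_lt_one.trans_le (le_max_right _ _)
  have hβL : ∀ r ∈ Icc (-M) M, deriv β r ≤ L := fun r hr =>
    (le_abs_self _).trans ((hL₀ r hr).trans (le_max_left _ _))
  obtain ⟨α, hα, hbα⟩ := hbβ (Icc (-M) M) isCompact_Icc
  have hBα : ∀ r ∈ Icc (-M) M, |deriv (fun r => b r * r) r| ≤ α * deriv β r := by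
    intro r hr
    have h1 : deriv (fun r => b r * r) r = deriv b r * r + b r := by
      simpa using ((hbd r).hasDerivAt.fun_mul (hasDerivAt_id' r)).deriv
    rw [h1]
    exact (hbα r hr).trans_eq (by rw [abs_of_nonneg (hβ' r)])
  obtain ⟨P, hP⟩ := (isCompact_Icc (a := -M) (b := M)).exists_bound_of_continuousOn
    hβ.continuous.continuousOn
  obtain ⟨Q, hQ⟩ := (isCompact_Icc (a := -M) (b := M)).exists_bound_of_continuousOn
    hBd.continuous.continuousOn
  have hQ0 : 0 ≤ Q := (norm_nonneg _).trans (hQ 0 ⟨by linarith, hM⟩)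
  have hsm : ∀ {k : ℝ → ℝ}, Continuous k → ∀ {u : ℝ × FokkerPlanck.Space d → ℝ},
      StronglyMeasurable u → StronglyMeasurable fun p => k (u p) :=
    fun hk _ hu => hk.comp_stronglyMeasurable hu
  have hDm : StronglyMeasurable fun p : ℝ × FokkerPlanck.Space d => D' p.2 :=
    hD'm.comp_measurable measurable_snd
  have hcore := FokkerPlanck.ae_slice_eq_zero_of_weak_equation hT
    (z := fun p => u₁ p - u₂ p) (w := fun p => β (u₁ p) - β (u₂ p))
    (G := fun p => (b (u₁ p) * u₁ p - b (u₂ p) * u₂ p) • D' p.2)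
    (hu₁m.sub hu₂m) ((hsm hβ.continuous hu₁m).sub (hsm hβ.continuous hu₂m))
    (((hsm hBd.continuous hu₁m).sub (hsm hBd.continuous hu₂m)).smul hDm)
    (M := max (M + M) (P + P)) (C := α * N) (L := L)
    (fun p => ((abs_sub _ _).trans (add_le_add (hM₁ p) (hM₂ p))).trans (le_max_left _ _))
    (fun p => ((abs_sub _ _).trans (add_le_add (hP _ (abs_le.1 (hM₁ p)))
      (hP _ (abs_le.1 (hM₂ p))))).trans (le_max_right _ _))
    (by positivity)
    (fun p => by
      have := FokkerPlanck.abs_sub_le_of_abs_deriv_le hBd hβd hBα (hM₁ p) (hM₂ p)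
      rw [abs_mul, abs_of_pos hα] at this
      rw [norm_smul]
      calc _ ≤ (α * |β (u₁ p) - β (u₂ p)|) * N :=
            mul_le_mul this (hD'N _) (norm_nonneg _) (by positivity)
        _ = _ := by ring)
    hL (fun p => FokkerPlanck.sq_sub_le_mul_of_deriv_le hβd hβ' hβL (hM₁ p) (hM₂ p)) ?_ ?_
  · rw [FokkerPlanck.volume_restrict_cylinder] at hyu₁ hyu₂ ⊢
    have h0 : ∀ᵐ p ∂((volume.restrict (Ioo 0 T)).prod (volume : Measure (FokkerPlanck.Space d))),
        u₁ p - u₂ p = 0 :=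
      (Measure.ae_prod_iff_ae_ae (p := fun p => u₁ p - u₂ p = 0)
        ((hu₁m.sub hu₂m).measurable (measurableSet_singleton 0))).2 hcore
    filter_upwards [hyu₁, hyu₂, h0] with p h1 h2 h3
    rw [h1, h2]
    exact sub_eq_zero.1 h3
  · intro χ hχ hχc hχs ψ hψ
    have hβm₁ := hsm hβ.continuous hu₁m
    have hβm₂ := hsm hβ.continuous hu₂m
    have hGm₁ : StronglyMeasurable fun p => (b (u₁ p) * u₁ p) • D' p.2 :=
      (hsm hBd.continuous hu₁m).smul hDm
    have hGm₂ : StronglyMeasurable fun p => (b (u₂ p) * u₂ p) • D' p.2 :=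
      (hsm hBd.continuous hu₂m).smul hDm
    have hβb₁ : ∀ p, ‖β (u₁ p)‖ ≤ P := fun p => hP _ (abs_le.1 (hM₁ p))
    have hβb₂ : ∀ p, ‖β (u₂ p)‖ ≤ P := fun p => hP _ (abs_le.1 (hM₂ p))
    have hGb₁ : ∀ p, ‖(b (u₁ p) * u₁ p) • D' p.2‖ ≤ Q * N := fun p => by
      rw [norm_smul]
      exact mul_le_mul (hQ _ (abs_le.1 (hM₁ p))) (hD'N _) (norm_nonneg _) hQ0
    have hGb₂ : ∀ p, ‖(b (u₂ p) * u₂ p) • D' p.2‖ ≤ Q * N := fun p => by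
      rw [norm_smul]
      exact mul_le_mul (hQ _ (abs_le.1 (hM₂ p))) (hD'N _) (norm_nonneg _) hQ0
    have h1 := hsol₁.eqn_prod hDD' hyu₁ hχ hχc hχs hψ
    have h2 := hsol₂.eqn_prod hDD' hyu₂ hχ hχc hχs hψ
    have h3 := integral_sub
      (FokkerPlanck.integrable_weak_integrand (T := T) hu₁m hβm₁ hGm₁ hM₁ hβb₁ hGb₁ hχ hχc hψ)
      (FokkerPlanck.integrable_weak_integrand (T := T) hu₂m hβm₂ hGm₂ hM₂ hβb₂ hGb₂ hχ hχc hψ)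
    rw [h1, h2, sub_zero] at h3
    have h4 := FokkerPlanck.integral_weak_integrand (T := T) (hu₁m.sub hu₂m) (hβm₁.sub hβm₂)
      (hGm₁.sub hGm₂) (fun p => (norm_sub_le _ _).trans (add_le_add (hM₁ p) (hM₂ p)))
      (fun p => (norm_sub_le _ _).trans (add_le_add (hβb₁ p) (hβb₂ p)))
      (fun p => (norm_sub_le _ _).trans (add_le_add (hGb₁ p) (hGb₂ p))) hχ hχc hψ
    simp only [sub_smul]
    refine h4.symm.trans (Eq.trans (integral_congr_ae (Eventually.of_forall fun p => ?_)) h3)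
    simp only [Pi.sub_apply, inner_sub_left]
    ring
  · intro ψ hψ
    refine (hlim ψ hψ).congr' ?_
    rw [FokkerPlanck.volume_restrict_cylinder] at hyu₁ hyu₂
    have hslice : ∀ᵐ s ∂(volume.restrict (Ioo 0 T)),
        ‖∫ x, (y₁ (s, x) - y₂ (s, x)) * ψ x‖ₑ = ‖∫ x, (u₁ (s, x) - u₂ (s, x)) * ψ x‖ₑ := by
      filter_upwards [Measure.ae_ae_of_ae_prod hyu₁, Measure.ae_ae_of_ae_prod hyu₂] with s h1 h2
      congr 1
      refine integral_congr_ae ?_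
      filter_upwards [h1, h2] with x h3 h4
      rw [h3, h4]
    have hlt : ∀ᶠ t : ℝ in 𝓝[>] 0, t < T := nhdsWithin_le_nhds (gt_mem_nhds hT)
    filter_upwards [hlt] with t ht
    exact essSup_congr_ae (ae_mono (Measure.restrict_mono (Ioo_subset_Ioo_right ht.le) le_rfl)
      hslice)
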